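/- **Setting.** Let $A\in\mathbb R^{n\times n}$, $B\in\mathbb R^{n\times m}$, $R\in\mathbb R^{n\times \ell}$, $C\in\mathbb R^{p\times n}$ and consider the system $\dot x=Ax+Bu+R\zeta$, $y=Cx$ with state $x$, input $u$, perturbation $\zeta$ and output $y$. For a number $\gamma>0$, a linear controller *solves $\gamma$-stabilization* of a system if the resulting closed loop $\dot x_c=A_cx_c+R_c\zeta$, $y=C_cx_c$ has a Hurwitz matrix $A_c$ (all eigenvalues have negative real part) and there are $P=P^{\mathsf T}>0$ and $\alpha,\beta>0$ with $\beta/\alpha=\gamma$ such that $V(x_c)=x_c^{\mathsf T}Px_c$ satisfies $\dot V\le-\alpha\|y\|^2+\beta\|\zeta\|^2$ along the closed loop, for all values of $x_c$ and $\zeta$. *Number of SVD steps of $(A,B)$.* Put $\Phi_0=A$, $\Gamma_0=B$. If $\Gamma_j$ does not have full row rank and $\Gamma_j\neq0$, take a singular value decomposition $\Gamma_j=U\begin{bmatrix}\Sigma&0\\0&0\end{bmatrix}H^{\mathsf T}$ with $U,H$ orthogonal and $\Sigma$ diagonal with the non-zero singular values on the diagonal, split $U=[\tilde U\ \bar U]$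 accordingly, and set $\Phi_{j+1}=\bar U^{\mathsf T}\Phi_j\bar U$, $\Gamma_{j+1}=\bar U^{\mathsf T}\Phi_j\tilde U$. The number of SVD steps is the index $l$ for which $\Gamma_l$ has full row rank. *Augmented system.* Let $B$ have full column rank and let $B^+$ be a left inverse of $B$, $B^+B=I$ (for instance the pseudo-inverse). For $M\in\mathbb R^{n_z\times n_z}$, $N\in\mathbb R^{n_z\times m}$, $Q\in\mathbb R^{m\times n_z}$ consider the system $\dot{\bar x}=\bar A\bar x+\bar Bu+\bar R\zeta$, $y=\bar C\bar x$ with state $\bar x=\mathrm{col}(x,z)$ and $$\bar A=\begin{bmatrix}A&BQ\\0&M+NQ\end{bmatrix},\quad \bar B=\begin{bmatrix}B\\N\end{bmatrix},\quad \bar R=\begin{bmatrix}R\\NB^+R\end{bmatrix},\quad \bar C=\begin{bmatrix}C&0\end{bmatrix}.$$ **Theorem (Dynamic Output Feedback).** Assume that $(A,B)$ is controllable, that $CA^{j-1}B=0$ for $j=1,\dots,l$, where $l$ is the number of SVD steps of $(A,B)$, that $(A,C)$ is detectable (that is, $A-L_0C$ is Hurwitz for some $L_0$), that $M$ is Hurwitz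 and that $(M,N)$ is controllable. Let $\gamma>0$ and let $K$ be such that the state feedback $u=Kx$ solves $\gamma$-stabilization of $\dot x=Ax+Bu+R\zeta$, $y=Cx$. 1. For every $L$ such that $\bar A-L\bar C$ is Hurwitz, the controller $$u=\begin{bmatrix}K&-Q\end{bmatrix}\chi,\qquad \dot\chi=\bar A\chi+L(y-\bar C\chi)+\bar Bu+\bar R\zeta$$ solves $\gamma$-stabilization of the augmented system, with the same $\gamma$. 2. Such an $L$ exists whenever $$\operatorname{rank}\begin{bmatrix}A-\lambda I&B\\C&0\end{bmatrix}=n+m\quad\text{for every eigenvalue }\lambda\text{ of }M+NQ\text{ with }\operatorname{Re}\lambda\ge0.$$ -/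

import Mathlib

open Matrix

namespace GammaStab

/-- A real square matrix is Hurwitz if all its complex eigenvalues have negative real part. -/
def IsHurwitz {n : Type*} [Fintype n] [DecidableEq n] (A : Matrix n n ℝ) : Prop :=
  ∀ μ ∈ spectrum ℂ (A.map (algebraMap ℝ ℂ)), μ.re < 0

/-- The controllability matrix `[B, AB, …, A^(d-1) B]`, where `d` is the state dimension. -/
def controllabilityMatrix {n m : Type*} [Fintype n] [DecidableEq n]
    (A : Matrix n n ℝ) (B : Matrix n m ℝ) : Matrix n (Fin (Fintype.card n) × m) ℝ :=
  Matrix.of fun i k => (A ^ (k.1 : ℕ) * B) i k.2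

/-- `(A, B)` is controllable: the controllability matrix has full row rank. -/
def IsControllable {n m : Type*} [Fintype n] [DecidableEq n] [Fintype m]
    (A : Matrix n n ℝ) (B : Matrix n m ℝ) : Prop :=
  (controllabilityMatrix A B).rank = Fintype.card n

/-- `(A, C)` is detectable: some output injection makes `A - L C` Hurwitz. -/
def IsDetectable {n p : Type*} [Fintype n] [DecidableEq n] [Fintype p]
    (A : Matrix n n ℝ) (C : Matrix p n ℝ) : Prop :=
  ∃ L : Matrix n p ℝ, IsHurwitz (A - L * C)

/-! ### The SVD algorithm -/

/-- `IsNumSVDSteps Φ Γ l`: the SVD reduction algorithm, started at the pair `(Φ, Γ)`, reaches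
a matrix `Γ_l` of full row rank after `l` steps.

If `Γ` has full row rank, the algorithm stops. Otherwise, if `Γ ≠ 0`, take a singular value
decomposition `Γ = U [[Σ, 0], [0, 0]] Hᵀ` with `U`, `H` orthogonal and `Σ` diagonal with positive
entries, split the columns `U = [U₁, U₂]` accordingly, and go on with the pair
`(U₂ᵀ Φ U₂, U₂ᵀ Φ U₁)`. -/
inductive IsNumSVDSteps : {d k : ℕ} →
    Matrix (Fin d) (Fin d) ℝ → Matrix (Fin d) (Fin k) ℝ → ℕ → Prop
  | full_row_rank {d k : ℕ} (Φ : Matrix (Fin d) (Fin d) ℝ) (Γ : Matrix (Fin d) (Fin k) ℝ) :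
      Γ.rank = d → IsNumSVDSteps Φ Γ 0
  | step {d k r q s l : ℕ} (Φ : Matrix (Fin d) (Fin d) ℝ) (Γ : Matrix (Fin d) (Fin k) ℝ)
      (U : Matrix (Fin d) (Fin r ⊕ Fin q) ℝ) (H : Matrix (Fin k) (Fin r ⊕ Fin s) ℝ)
      (σ : Fin r → ℝ) :
      Γ.rank ≠ d → Γ ≠ 0 →
      U * Uᵀ = 1 → Uᵀ * U = 1 → H * Hᵀ = 1 → Hᵀ * H = 1 →
      (∀ i, 0 < σ i) → Γ = U * (fromBlocks (diagonal σ) 0 0 0 : Matrix (Fin r ⊕ Fin q) (Fin r ⊕ Fin s) ℝ) * Hᵀ →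
      IsNumSVDSteps (U.toCols₂ᵀ * Φ * U.toCols₂) (U.toCols₂ᵀ * Φ * U.toCols₁) l →
      IsNumSVDSteps Φ Γ (l + 1)

/-! ### Quadratic IOS-Lyapunov functions and the external gain -/

/-- The quadratic function `V(x) = xᵀ P x`. -/
def quadForm {n : Type*} [Fintype n] (P : Matrix n n ℝ) (x : n → ℝ) : ℝ := x ⬝ᵥ (P *ᵥ x)

/-- The derivative of `V(x) = xᵀ P x` along `dx/dt = v`, see `hasDerivAt_quadForm`. -/
def quadFormDot {n : Type*} [Fintype n] (P : Matrix n n ℝ) (x v : n → ℝ) : ℝ :=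
  v ⬝ᵥ (P *ᵥ x) + x ⬝ᵥ (P *ᵥ v)

theorem hasDerivAt_quadForm {n : Type*} [Fintype n] (P : Matrix n n ℝ) {x : ℝ → n → ℝ}
    {v : n → ℝ} {t : ℝ} (hx : HasDerivAt x v t) :
    HasDerivAt (fun s => quadForm P (x s)) (quadFormDot P (x t) v) t := by
  have h1 : ∀ i, HasDerivAt (fun s => x s i) (v i) t := hasDerivAt_pi.1 hx
  have h2 : ∀ i, HasDerivAt (fun s => (P *ᵥ x s) i) ((P *ᵥ v) i) t := fun i => by
    simp only [mulVec, dotProduct]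
    exact HasDerivAt.fun_sum fun j _ => (h1 j).const_mul (P i j)
  have h3 := HasDerivAt.fun_sum (u := Finset.univ) fun i _ => (h1 i).fun_mul (h2 i)
  simp only [Finset.sum_add_distrib] at h3
  exact h3

/-- The system `dx/dt = A x + R ζ`, `y = C x` has external gain `γ` from `ζ` to `y`: there are
`P = Pᵀ > 0` and `α, β > 0` with `β / α = γ` such that `V(x) = xᵀ P x` satisfies
`dV/dt ≤ -α ‖y‖² + β ‖ζ‖²` (Euclidean norms) along the system. -/
def HasExternalGain {n p q : Type*} [Fintype n] [Fintype p] [Fintype q]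
    (A : Matrix n n ℝ) (R : Matrix n q ℝ) (C : Matrix p n ℝ) (γ : ℝ) : Prop :=
  ∃ P : Matrix n n ℝ, P.PosDef ∧ ∃ α β : ℝ, 0 < α ∧ 0 < β ∧ β / α = γ ∧
    ∀ (x : n → ℝ) (ζ : q → ℝ),
      quadFormDot P x (A *ᵥ x + R *ᵥ ζ) ≤ -α * ((C *ᵥ x) ⬝ᵥ (C *ᵥ x)) + β * (ζ ⬝ᵥ ζ)

/-! ### Control systems and controllers -/

/-- The data of the control system `dx/dt = A x + B u + R ζ`, `y = C x` with state indexed by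
`n`, input by `m`, output by `p` and external perturbation by `q`. -/
structure ControlSystem (n m p q : Type*) where
  /-- state matrix -/
  A : Matrix n n ℝ
  /-- input matrix -/
  B : Matrix n m ℝ
  /-- perturbation matrix -/
  R : Matrix n q ℝ
  /-- output matrix -/
  C : Matrix p n ℝ

namespace ControlSystem

/-- The static controller `u = K x` solves `γ`-stabilization: the closed loop
`dx/dt = (A + B K) x + R ζ`, `y = C x` has a Hurwitz state matrix and external gain `γ`. -/
def SolvedByStateFeedback {n m p q : Type*} [Fintype n] [DecidableEq n] [Fintype m] [Fintype p]
    [Fintype q] (S : ControlSystem n m p q) (γ : ℝ) (K : Matrix m n ℝ) : Prop :=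
  IsHurwitz (S.A + S.B * K) ∧ HasExternalGain (S.A + S.B * K) S.R S.C γ

/-- State matrix, for the state `col(x, χ)`, of the closed loop with the dynamic controller
`u = K χ`, `dχ/dt = A χ + L (y - C χ) + B u + R ζ`. -/
def observerA {n m p q : Type*} [Fintype n] [Fintype m] [Fintype p]
    (S : ControlSystem n m p q) (K : Matrix m n ℝ) (L : Matrix n p ℝ) :
    Matrix (n ⊕ n) (n ⊕ n) ℝ :=
  fromBlocks S.A (S.B * K) (L * S.C) (S.A - L * S.C + S.B * K)

/-- Perturbation matrix of the closed loop with the dynamic controller. -/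
def observerR {n m p q : Type*} (S : ControlSystem n m p q) : Matrix (n ⊕ n) q ℝ :=
  fromRows S.R S.R

/-- Output matrix of the closed loop with the dynamic controller. -/
def observerC {n m p q : Type*} (S : ControlSystem n m p q) : Matrix p (n ⊕ n) ℝ :=
  fromCols S.C 0

/-- The closed loop matrices above are those of the plant and the controller equations. -/
theorem observer_closedLoop {n m p q : Type*} [Fintype n] [Fintype m] [Fintype p] [Fintype q]
    (S : ControlSystem n m p q) (K : Matrix m n ℝ) (L : Matrix n p ℝ) (x χ : n → ℝ) (ζ : q → ℝ) :
    S.observerA K L *ᵥ Sum.elim x χ + S.observerR *ᵥ ζ =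
      Sum.elim (S.A *ᵥ x + S.B *ᵥ (K *ᵥ χ) + S.R *ᵥ ζ)
        (S.A *ᵥ χ + L *ᵥ (S.C *ᵥ x - S.C *ᵥ χ) + S.B *ᵥ (K *ᵥ χ) + S.R *ᵥ ζ) ∧
    S.observerC *ᵥ Sum.elim x χ = S.C *ᵥ x := by
  constructor
  · ext i
    rcases i with i | i
    · simp [observerA, observerR, fromBlocks_mulVec, fromRows_mulVec]
    · simp [observerA, observerR, fromBlocks_mulVec, fromRows_mulVec, mulVec_sub, add_mulVec,
        sub_mulVec]
      ring
  · ext i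
    simp [observerC, fromCols_mulVec]

/-- The dynamic controller `u = K χ`, `dχ/dt = A χ + L (y - C χ) + B u + R ζ` solves
`γ`-stabilization: the closed loop has a Hurwitz state matrix and external gain `γ`. -/
def SolvedByOutputFeedback {n m p q : Type*} [Fintype n] [DecidableEq n] [Fintype m] [Fintype p]
    [Fintype q] (S : ControlSystem n m p q) (γ : ℝ) (K : Matrix m n ℝ) (L : Matrix n p ℝ) : Prop :=
  IsHurwitz (S.observerA K L) ∧ HasExternalGain (S.observerA K L) S.observerR S.observerC γ

/-- The augmented system with state `col(x, z)` and matrices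
`[[A, B Q], [0, M + N Q]]`, `col(B, N)`, `col(R, N B⁺ R)`, `[C, 0]`. -/
def augmented {n m p q z : Type*} [Fintype n] [Fintype m] [Fintype p] [Fintype q] [Fintype z]
    (S : ControlSystem n m p q) (Bplus : Matrix m n ℝ)
    (M : Matrix z z ℝ) (N : Matrix z m ℝ) (Q : Matrix m z ℝ) :
    ControlSystem (n ⊕ z) m p q where
  A := fromBlocks S.A (S.B * Q) 0 (M + N * Q)
  B := fromRows S.B N
  R := fromRows S.R (N * Bplus * S.R)
  C := fromCols S.C 0

end ControlSystem

end GammaStab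

namespace GammaStab

/-! Put e = col(x, z) - χ. The perturbation cancels from the error equation, so e is autonomous and
decays under Ā - LC̄. The summand -Q of the controller compensates BQz, and x obeys dx/dt = (A +
BK)x - B[K, -Q]e + Rζ, y = Cx. So the state feedback loop is driven by an additional decaying
signal, and its gain has to survive with the same α and β, without slack to absorb the cross terms.

Storage matrices are the symmetric solutions of a Riccati inequality (`isStorage_iff`). If one of
minimal trace is chosen, the loop under the worst perturbation has no eigenvalue in the open right
half plane (`exists_minimal_storage`). A Sylvester equation then removes the cross block exactly and
a Lyapunov equation removes the error block (`exists_cascade_storage`). The resulting form, pulled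
back to the full closed loop, vanishes where x = 0 and e = 0, hence is only semidefinite; as the
closed loop is Hurwitz, `exists_posDef_storage` perturbs it into a definite one.

For the existence of L, the Hautus test (`exists_isHurwitz_sub_mul`) leaves only unstable
eigenvectors in the kernel of C̄. Detectability of (A, C) excludes those without z-component; the
rank condition forces Qw = 0 for the z-component w of the others, against M being Hurwitz. -/

theorem re_map_mulVec {m n : Type*} [Fintype n] (A : Matrix m n ℝ) (v : n → ℂ) (i : m) :
    ((A.map (algebraMap ℝ ℂ) *ᵥ v) i).re = (A *ᵥ fun j => (v j).re) i := by
  simp [mulVec, dotProduct]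

theorem im_map_mulVec {m n : Type*} [Fintype n] (A : Matrix m n ℝ) (v : n → ℂ) (i : m) :
    ((A.map (algebraMap ℝ ℂ) *ᵥ v) i).im = (A *ᵥ fun j => (v j).im) i := by
  simp [mulVec, dotProduct]

/-- A complex eigenvector of a real matrix, split into real and imaginary part. -/
theorem mulVec_re_im_of_eigenvector {n : Type*} [Fintype n] {A : Matrix n n ℝ} {μ : ℂ} {v : n → ℂ}
    (h : A.map (algebraMap ℝ ℂ) *ᵥ v = μ • v) :
    (A *ᵥ fun j => (v j).re) = μ.re • (fun j => (v j).re) - μ.im • (fun j => (v j).im) ∧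
    (A *ᵥ fun j => (v j).im) = μ.im • (fun j => (v j).re) + μ.re • (fun j => (v j).im) := by
  constructor
  · ext i
    rw [← re_map_mulVec, h]
    simp
  · ext i
    rw [← im_map_mulVec, h]
    simp
    ring

/-! ### Spectra of real matrices and Sylvester equations -/

section Spectrum

variable {n m : Type*} [Fintype n] [DecidableEq n] [Fintype m] [DecidableEq m]

theorem mem_spectrum_iff_exists_mulVec {k : Type*} [Field k] (A : Matrix n n k) (μ : k) :
    μ ∈ spectrum k A ↔ ∃ v, v ≠ 0 ∧ A *ᵥ v = μ • v := by
  rw [spectrum.mem_iff, Matrix.isUnit_iff_isUnit_det, isUnit_iff_ne_zero, not_not,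
    ← exists_mulVec_eq_zero_iff]
  refine exists_congr fun v => and_congr_right fun _ => ?_
  rw [sub_mulVec, sub_eq_zero, Algebra.algebraMap_eq_smul_one, smul_mulVec, one_mulVec, eq_comm]

theorem isHurwitz_iff (A : Matrix n n ℝ) :
    IsHurwitz A ↔ ∀ (μ : ℂ) (v : n → ℂ), v ≠ 0 → A.map (algebraMap ℝ ℂ) *ᵥ v = μ • v → μ.re < 0 := by
  simp only [IsHurwitz, mem_spectrum_iff_exists_mulVec]
  exact ⟨fun h μ v hv e => h μ ⟨v, hv, e⟩, fun h μ ⟨v, hv, e⟩ => h μ v hv e⟩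

theorem aeval_charpoly_eq_zero_iff (A : Matrix n n ℝ) (μ : ℂ) :
    Polynomial.aeval μ A.charpoly = 0 ↔ μ ∈ spectrum ℂ (A.map (algebraMap ℝ ℂ)) := by
  rw [mem_spectrum_iff_isRoot_charpoly, charpoly_map, Polynomial.IsRoot, Polynomial.eval_map_algebraMap]

/-! ### The Sylvester equation -/

theorem aeval_mul_comm_of_intertwine {A : Matrix n n ℝ} {B : Matrix m m ℝ} {X : Matrix n m ℝ}
    (h : A * X = X * B) (f : Polynomial ℝ) :
    Polynomial.aeval A f * X = X * Polynomial.aeval B f := by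
  have hp : ∀ k : ℕ, A ^ k * X = X * B ^ k := by
    intro k
    induction k with
    | zero => simp
    | succ k ih => rw [pow_succ, Matrix.mul_assoc, h, ← Matrix.mul_assoc, ih, Matrix.mul_assoc,
        ← pow_succ]
  induction f using Polynomial.induction_on' with
  | add p q hp hq => simp [Matrix.add_mul, Matrix.mul_add, hp, hq]
  | monomial k a =>
    simp [Polynomial.aeval_monomial, Algebra.algebraMap_eq_smul_one, hp]

/-- Disjoint spectra make the characteristic polynomials of A and -B coprime. A Bézout combination
evaluated on both sides of AX = X(-B) gives 0 on the left and X on the right. -/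
theorem sylvester_injective {A : Matrix n n ℝ} {B : Matrix m m ℝ}
    (h : ∀ μ ∈ spectrum ℂ (A.map (algebraMap ℝ ℂ)),
      μ ∉ spectrum ℂ ((-B).map (algebraMap ℝ ℂ)))
    {X : Matrix n m ℝ} (hX : A * X + X * B = 0) : X = 0 := by
  have hc : IsCoprime A.charpoly (-B).charpoly := by
    rw [Polynomial.isCoprime_iff_aeval_ne_zero_of_isAlgClosed ℝ ℂ]
    intro μ
    by_contra! hμ
    exact h μ ((aeval_charpoly_eq_zero_iff A μ).1 hμ.1) ((aeval_charpoly_eq_zero_iff _ μ).1 hμ.2)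
  obtain ⟨u, v, huv⟩ := hc
  have hX' : A * X = X * (-B) := by
    rw [Matrix.mul_neg]; exact eq_neg_of_add_eq_zero_left hX
  have h1 := aeval_mul_comm_of_intertwine hX' (u * A.charpoly)
  have h2 := congrArg (Polynomial.aeval (-B)) huv
  simp only [map_add, map_mul, aeval_self_charpoly, mul_zero, Matrix.zero_mul, add_zero,
    map_one] at h1 h2
  rw [h2, Matrix.mul_one] at h1
  exact h1.symm

theorem exists_sylvester {A : Matrix n n ℝ} {B : Matrix m m ℝ}
    (h : ∀ μ ∈ spectrum ℂ (A.map (algebraMap ℝ ℂ)),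
      μ ∉ spectrum ℂ ((-B).map (algebraMap ℝ ℂ)))
    (D : Matrix n m ℝ) : ∃ X : Matrix n m ℝ, A * X + X * B = D := by
  let S : Matrix n m ℝ →ₗ[ℝ] Matrix n m ℝ :=
    { toFun := fun X => A * X + X * B
      map_add' := fun X Y => by simp only [Matrix.mul_add, Matrix.add_mul]; abel
      map_smul' := fun c X => by simp }
  have hinj : Function.Injective S :=
    (injective_iff_map_eq_zero S).2 fun X hX => sylvester_injective h hX
  exact LinearMap.injective_iff_surjective.1 hinj D

theorem mem_spectrum_neg_map_iff (A : Matrix n n ℝ) (μ : ℂ) :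
    μ ∈ spectrum ℂ ((-A).map (algebraMap ℝ ℂ)) ↔ -μ ∈ spectrum ℂ (A.map (algebraMap ℝ ℂ)) := by
  rw [mem_spectrum_iff_exists_mulVec, mem_spectrum_iff_exists_mulVec]
  refine exists_congr fun v => and_congr_right fun _ => ?_
  rw [show (-A).map (algebraMap ℝ ℂ) = -(A.map (algebraMap ℝ ℂ)) by ext; simp, neg_mulVec,
    neg_smul, neg_eq_iff_eq_neg]

theorem mem_spectrum_transpose_map_iff (A : Matrix n n ℝ) (μ : ℂ) :
    μ ∈ spectrum ℂ (Aᵀ.map (algebraMap ℝ ℂ)) ↔ μ ∈ spectrum ℂ (A.map (algebraMap ℝ ℂ)) := by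
  rw [← aeval_charpoly_eq_zero_iff, ← aeval_charpoly_eq_zero_iff, charpoly_transpose]

end Spectrum

/-! ### Lyapunov's equation -/

/-- Real symmetric matrices and their quadratic forms. -/
theorem posSemidef_real_iff {n : Type*} [Fintype n] (P : Matrix n n ℝ) :
    P.PosSemidef ↔ Pᵀ = P ∧ ∀ x, 0 ≤ x ⬝ᵥ (P *ᵥ x) := by
  rw [posSemidef_iff_dotProduct_mulVec]
  simp [IsHermitian, conjTranspose_eq_transpose_of_trivial]

section Lyapunov

variable {n : Type*} [Fintype n] [DecidableEq n]

-- Gelfand's formula over ℂ bounds the powers by a geometric sequence; real parts bring the limit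
-- back to ℝ.
open Filter Topology in
theorem tendsto_pow_zero_of_spectrum_lt_one (S : Matrix n n ℝ)
    (h : ∀ μ ∈ spectrum ℂ (S.map (algebraMap ℝ ℂ)), ‖μ‖ < 1) :
    Tendsto (fun k : ℕ => S ^ k) atTop (𝓝 0) := by
  let _ := Matrix.linftyOpNormedRing (n := n) (α := ℂ)
  let _ := Matrix.linftyOpNormedAlgebra (n := n) (R := ℂ) (α := ℂ)
  set T := S.map (algebraMap ℝ ℂ) with hT
  have hTk : Tendsto (fun k : ℕ => T ^ k) atTop (𝓝 0) := by
    rcases subsingleton_or_nontrivial (Matrix n n ℂ) with hs | hs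
    · exact (tendsto_const_nhds (x := (0 : Matrix n n ℂ))).congr fun k => Subsingleton.elim _ _
    have hr : spectralRadius ℂ T < ((1 : NNReal) : ENNReal) :=
      spectrum.spectralRadius_lt_of_forall_lt T fun μ hμ => by
        have := h μ hμ
        exact_mod_cast this
    obtain ⟨r, hr0, hr1⟩ := ENNReal.lt_iff_exists_nnreal_btwn.1 hr
    have hev := (spectrum.pow_nnnorm_pow_one_div_tendsto_nhds_spectralRadius T).eventually_lt_const hr0
    refine squeeze_zero_norm' (a := fun k : ℕ => (r : ℝ) ^ k) ?_
      (tendsto_pow_atTop_nhds_zero_of_lt_one r.2 (by exact_mod_cast hr1))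
    filter_upwards [hev, eventually_gt_atTop 0] with k hk hk0
    have hk' : (‖T ^ k‖₊ : ENNReal) ≤ (r : ENNReal) ^ k := by
      have := pow_le_pow_left' hk.le k
      rwa [← ENNReal.rpow_natCast, ← ENNReal.rpow_mul, one_div, inv_mul_cancel₀ (by positivity),
        ENNReal.rpow_one] at this
    exact_mod_cast hk'
  have hre : ∀ k, S ^ k = (T ^ k).map Complex.re := by
    intro k
    have : T ^ k = (S ^ k).map (algebraMap ℝ ℂ) := ((algebraMap ℝ ℂ).mapMatrix.map_pow S k).symm
    rw [this]; ext; simp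
  simp_rw [hre]
  have hcont : Continuous fun M : Matrix n n ℂ => M.map Complex.re :=
    continuous_id.matrix_map Complex.continuous_re
  simpa [Function.comp_def] using (hcont.tendsto 0).comp hTk

theorem one_sub_isUnit_of_isHurwitz {F : Matrix n n ℝ} (hF : IsHurwitz F) : IsUnit (1 - F) := by
  rw [isUnit_iff_isUnit_det, isUnit_iff_ne_zero]
  intro h
  obtain ⟨v, hv, h⟩ := exists_mulVec_eq_zero_iff.2 h
  rw [sub_mulVec, one_mulVec, sub_eq_zero] at h
  have := (isHurwitz_iff F).1 hF 1 (fun i => (v i : ℂ))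
    (fun h0 => hv (funext fun i => by simpa using congrFun h0 i)) (by
      have hi : ∀ i, (F *ᵥ v) i = v i := fun i => (congrFun h i).symm
      ext i
      apply Complex.ext
      · rw [re_map_mulVec]; simpa using hi i
      · rw [im_map_mulVec]; simp [mulVec, dotProduct])
  norm_num at this

/-- The Cayley transform of a Hurwitz matrix has its spectrum in the open unit disc. -/
theorem norm_lt_one_of_mem_spectrum_cayley {F : Matrix n n ℝ} (hF : IsHurwitz F) (μ : ℂ)
    (hμ : μ ∈ spectrum ℂ (((1 + F) * (1 - F)⁻¹).map (algebraMap ℝ ℂ))) : ‖μ‖ < 1 := by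
  have hu := (isUnit_iff_isUnit_det _).1 (one_sub_isUnit_of_isHurwitz hF)
  obtain ⟨v, hv, h⟩ := (mem_spectrum_iff_exists_mulVec _ _).1 hμ
  set f := (algebraMap ℝ ℂ).mapMatrix (m := n) with hf
  have e1 : f (1 - F) * f (1 - F)⁻¹ = 1 := by
    rw [← map_mul, mul_nonsing_inv _ hu, map_one]
  -- This w is an eigenvector of F for λ = (μ - 1) / (1 + μ), and Re λ < 0 is equivalent to ‖μ‖ < 1.
  set w := f (1 - F)⁻¹ *ᵥ v with hw
  have hvw : v = w - f F *ᵥ w := by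
    have : f (1 - F) *ᵥ w = v := by rw [hw, mulVec_mulVec, e1, one_mulVec]
    rw [← this, map_sub, map_one, sub_mulVec, one_mulVec]
  have hw0 : w ≠ 0 := by
    rintro h0; rw [h0] at hvw; exact hv (by simpa using hvw)
  have h' : w + f F *ᵥ w = μ • (w - f F *ᵥ w) := by
    rw [← hvw, ← h]
    change _ = f ((1 + F) * (1 - F)⁻¹) *ᵥ v
    rw [map_mul, ← mulVec_mulVec, ← hw, map_add, map_one, add_mulVec, one_mulVec]
  have h2 : (1 + μ) • (f F *ᵥ w) = (μ - 1) • w := by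
    have : (1 + μ) • (f F *ᵥ w) - (μ - 1) • w
      = (w + f F *ᵥ w) - μ • (w - f F *ᵥ w) := by module
    rw [← sub_eq_zero, this, h', sub_self]
  have hμ1 : 1 + μ ≠ 0 := by
    intro h0
    rw [h0, zero_smul, eq_comm, smul_eq_zero] at h2
    rcases h2 with h2 | h2
    · have : (2 : ℂ) = 0 := by linear_combination h0 - h2
      norm_num at this
    · exact hw0 h2
  have h3 := (isHurwitz_iff F).1 hF ((μ - 1) / (1 + μ)) w hw0 (by
    change f F *ᵥ w = _
    rw [div_eq_inv_mul, mul_smul, ← h2, smul_smul, inv_mul_cancel₀ hμ1, one_smul])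
  have hpos : 0 < Complex.normSq (1 + μ) := Complex.normSq_pos.2 hμ1
  rw [Complex.div_re, ← add_div, div_neg_iff] at h3
  rcases h3 with h3 | h3
  · linarith [h3.2]
  have h4 := h3.1
  simp at h4
  have : Complex.normSq μ < 1 := by rw [Complex.normSq_apply]; nlinarith
  rw [Complex.normSq_eq_norm_sq] at this
  exact (sq_lt_one_iff₀ (norm_nonneg _)).1 this

-- A discrete-time argument: the Lyapunov inequality makes the form of P nonincreasing along the
-- iterates of the Cayley transform S. As S ^ k tends to 0, the form dominates its limit 0.
open Filter Topology in
theorem posSemidef_of_lyapunov {F P : Matrix n n ℝ} (hF : IsHurwitz F) (hP : Pᵀ = P)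
    (h : (-(Fᵀ * P + P * F)).PosSemidef) : P.PosSemidef := by
  have hu := (isUnit_iff_isUnit_det _).1 (one_sub_isUnit_of_isHurwitz hF)
  set D := 1 - F with hD
  set S := (1 + F) * D⁻¹ with hS
  have hSD : S * D = 1 + F := by rw [hS, Matrix.mul_assoc, nonsing_inv_mul _ hu, Matrix.mul_one]
  have hstep : ∀ x, (S *ᵥ x) ⬝ᵥ (P *ᵥ (S *ᵥ x)) ≤ x ⬝ᵥ (P *ᵥ x) := by
    intro x
    obtain ⟨y, rfl⟩ : ∃ y, x = D *ᵥ y := ⟨D⁻¹ *ᵥ x, by rw [mulVec_mulVec, mul_nonsing_inv _ hu, one_mulVec]⟩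
    have h1 := ((posSemidef_real_iff _).1 h).2 y
    have h2 : y ⬝ᵥ (Fᵀ *ᵥ (P *ᵥ y)) = (F *ᵥ y) ⬝ᵥ (P *ᵥ y) := by
      rw [dotProduct_mulVec, vecMul_transpose]
    rw [mulVec_mulVec, hSD, hD, sub_mulVec, add_mulVec, one_mulVec]
    simp only [neg_mulVec, add_mulVec, dotProduct_neg, dotProduct_add, mulVec_add, mulVec_sub,
      ← mulVec_mulVec, dotProduct_sub, add_dotProduct, sub_dotProduct, h2] at h1 ⊢
    linarith
  have hiter : ∀ (x : n → ℝ) (k : ℕ), (S ^ k *ᵥ x) ⬝ᵥ (P *ᵥ (S ^ k *ᵥ x)) ≤ x ⬝ᵥ (P *ᵥ x) := by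
    intro x k
    induction k with
    | zero => simp
    | succ k ih =>
      rw [pow_succ', ← mulVec_mulVec]
      exact (hstep _).trans ih
  rw [posSemidef_real_iff]
  refine ⟨hP, fun x => ?_⟩
  have hlim := tendsto_pow_zero_of_spectrum_lt_one S (norm_lt_one_of_mem_spectrum_cayley hF)
  have hc : Continuous fun M : Matrix n n ℝ => (M *ᵥ x) ⬝ᵥ (P *ᵥ (M *ᵥ x)) := by fun_prop
  have h0 := (hc.tendsto 0).comp hlim
  simp only [zero_mulVec, zero_dotProduct] at h0
  exact le_of_tendsto h0 (Eventually.of_forall fun k => hiter x k)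

/-- Only the closed half plane is needed for A, since the spectrum of -E lies in the open right one.
This is what allows worst case loops with imaginary eigenvalues. -/
theorem IsHurwitz.sylvester_cond {n m : Type*} [Fintype n] [DecidableEq n] [Fintype m]
    [DecidableEq m] {A : Matrix n n ℝ} {E : Matrix m m ℝ}
    (hA : ∀ μ ∈ spectrum ℂ (A.map (algebraMap ℝ ℂ)), μ.re ≤ 0) (hE : IsHurwitz E) :
    ∀ μ ∈ spectrum ℂ (Aᵀ.map (algebraMap ℝ ℂ)), μ ∉ spectrum ℂ ((-E).map (algebraMap ℝ ℂ)) := by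
  intro μ hμ h
  have h1 := hA μ ((mem_spectrum_transpose_map_iff A μ).1 hμ)
  have h2 := hE _ ((mem_spectrum_neg_map_iff E μ).1 h)
  simp at h2
  linarith

theorem exists_lyapunov {F : Matrix n n ℝ} (hF : IsHurwitz F) {Q : Matrix n n ℝ} (hQ : Qᵀ = Q) :
    ∃ P : Matrix n n ℝ, Pᵀ = P ∧ Fᵀ * P + P * F = -Q := by
  obtain ⟨P, hP⟩ := exists_sylvester (IsHurwitz.sylvester_cond (fun μ hμ => (hF μ hμ).le) hF) (-Q)
  refine ⟨(1 / 2 : ℝ) • (P + Pᵀ), by simp [add_comm], ?_⟩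
  have hT := congrArg transpose hP
  simp only [transpose_add, transpose_mul, transpose_transpose, transpose_neg, hQ] at hT
  have : Fᵀ * ((1 / 2 : ℝ) • (P + Pᵀ)) + ((1 / 2 : ℝ) • (P + Pᵀ)) * F
      = (1 / 2 : ℝ) • ((Fᵀ * P + P * F) + (Pᵀ * F + Fᵀ * Pᵀ)) := by
    simp only [Matrix.mul_smul, Matrix.smul_mul, Matrix.mul_add, Matrix.add_mul, ← smul_add]
    congr 1; abel
  rw [this, hP, hT]; module

end Lyapunov

/-! ### Storage functions and the Riccati inequality -/

section Riccati

variable {n p q k : Type*} [Fintype n] [Fintype p] [Fintype q] [Fintype k]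

/-- The Riccati expression of the dissipation inequality with supply rate `-α ‖y‖² + β ‖ζ‖²`. -/
noncomputable def riccati (F : Matrix n n ℝ) (R : Matrix n q ℝ) (C : Matrix p n ℝ) (α β : ℝ)
    (P : Matrix n n ℝ) : Matrix n n ℝ :=
  Fᵀ * P + P * F + α • (Cᵀ * C) + β⁻¹ • (P * R * (Rᵀ * P))

/-- The closed loop with the worst perturbation `ζ = β⁻¹ Rᵀ P x`. -/
noncomputable def worstCase (F : Matrix n n ℝ) (R : Matrix n q ℝ) (β : ℝ) (P : Matrix n n ℝ) : Matrix n n ℝ :=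
  F + β⁻¹ • (R * (Rᵀ * P))

/-- The quadratic form of `P` satisfies the dissipation inequality. -/
def IsStorage (F : Matrix n n ℝ) (R : Matrix n q ℝ) (C : Matrix p n ℝ) (α β : ℝ)
    (P : Matrix n n ℝ) : Prop :=
  ∀ (x : n → ℝ) (ζ : q → ℝ),
    quadFormDot P x (F *ᵥ x + R *ᵥ ζ) ≤ -α * ((C *ᵥ x) ⬝ᵥ (C *ᵥ x)) + β * (ζ ⬝ᵥ ζ)

theorem dotProduct_transpose_mulVec (A : Matrix k n ℝ) (x : n → ℝ) (y : k → ℝ) :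
    x ⬝ᵥ (Aᵀ *ᵥ y) = (A *ᵥ x) ⬝ᵥ y := by
  rw [dotProduct_mulVec, vecMul_transpose]

theorem dotProduct_mulVec_of_symm {P : Matrix n n ℝ} (hP : Pᵀ = P) (x y : n → ℝ) :
    x ⬝ᵥ (P *ᵥ y) = (P *ᵥ x) ⬝ᵥ y := by
  conv_lhs => rw [← hP]
  exact dotProduct_transpose_mulVec P x y

theorem riccati_transpose {F : Matrix n n ℝ} {R : Matrix n q ℝ} {C : Matrix p n ℝ} {α β : ℝ}
    {P : Matrix n n ℝ} (hP : Pᵀ = P) : (riccati F R C α β P)ᵀ = riccati F R C α β P := by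
  simp only [riccati, transpose_add, transpose_mul, transpose_smul, transpose_transpose, hP,
    Matrix.mul_assoc]
  abel

theorem riccati_form {F : Matrix n n ℝ} {R : Matrix n q ℝ} {C : Matrix p n ℝ} {α β : ℝ}
    {P : Matrix n n ℝ} (hP : Pᵀ = P) (x : n → ℝ) :
    x ⬝ᵥ (riccati F R C α β P *ᵥ x) = 2 * ((F *ᵥ x) ⬝ᵥ (P *ᵥ x)) +
      α * ((C *ᵥ x) ⬝ᵥ (C *ᵥ x)) + β⁻¹ * ((Rᵀ *ᵥ (P *ᵥ x)) ⬝ᵥ (Rᵀ *ᵥ (P *ᵥ x))) := by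
  have h1 : x ⬝ᵥ (P *ᵥ (F *ᵥ x)) = (F *ᵥ x) ⬝ᵥ (P *ᵥ x) := by
    rw [dotProduct_mulVec_of_symm hP, dotProduct_comm]
  have h2 : x ⬝ᵥ (P *ᵥ (R *ᵥ (Rᵀ *ᵥ (P *ᵥ x)))) =
      (Rᵀ *ᵥ (P *ᵥ x)) ⬝ᵥ (Rᵀ *ᵥ (P *ᵥ x)) := by
    rw [dotProduct_mulVec_of_symm hP, ← dotProduct_transpose_mulVec Rᵀ, transpose_transpose]
  simp only [riccati, add_mulVec, smul_mulVec, ← mulVec_mulVec, dotProduct_add, dotProduct_smul,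
    dotProduct_transpose_mulVec, smul_eq_mul, h1, h2]
  ring

theorem quadFormDot_eq {F : Matrix n n ℝ} {R : Matrix n q ℝ} {P : Matrix n n ℝ} (hP : Pᵀ = P)
    (x : n → ℝ) (ζ : q → ℝ) :
    quadFormDot P x (F *ᵥ x + R *ᵥ ζ) =
      2 * ((F *ᵥ x) ⬝ᵥ (P *ᵥ x)) + 2 * (ζ ⬝ᵥ (Rᵀ *ᵥ (P *ᵥ x))) := by
  rw [quadFormDot, dotProduct_mulVec_of_symm hP x, dotProduct_comm (P *ᵥ x), add_dotProduct,
    ← transpose_transpose R, dotProduct_transpose_mulVec]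
  ring

/-- Completing the square in ζ: the worst perturbation is β⁻¹RᵀPx, and inserting it leaves the
Riccati form. -/
theorem isStorage_iff {F : Matrix n n ℝ} {R : Matrix n q ℝ} {C : Matrix p n ℝ} {α β : ℝ}
    (hβ : 0 < β) {P : Matrix n n ℝ} (hP : Pᵀ = P) :
    IsStorage F R C α β P ↔ (-(riccati F R C α β P)).PosSemidef := by
  rw [posSemidef_real_iff]
  simp only [transpose_neg, riccati_transpose hP, true_and, neg_mulVec, dotProduct_neg,
    riccati_form hP, IsStorage, quadFormDot_eq hP]
  constructor
  · intro h x
    have := h x (β⁻¹ • (Rᵀ *ᵥ (P *ᵥ x)))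
    simp only [smul_dotProduct, dotProduct_smul, smul_eq_mul] at this
    have e : β * (β⁻¹ * (β⁻¹ * ((Rᵀ *ᵥ (P *ᵥ x)) ⬝ᵥ (Rᵀ *ᵥ (P *ᵥ x))))) =
        β⁻¹ * ((Rᵀ *ᵥ (P *ᵥ x)) ⬝ᵥ (Rᵀ *ᵥ (P *ᵥ x))) := by
      field_simp
    linarith
  · intro h x ζ
    have h1 := h x
    set w := Rᵀ *ᵥ (P *ᵥ x)
    have h2 : 0 ≤ β * ((ζ - β⁻¹ • w) ⬝ᵥ (ζ - β⁻¹ • w)) :=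
      mul_nonneg hβ.le (by simpa using dotProduct_star_self_nonneg (ζ - β⁻¹ • w))
    have h3 : β * ((ζ - β⁻¹ • w) ⬝ᵥ (ζ - β⁻¹ • w)) =
        β * (ζ ⬝ᵥ ζ) - 2 * (ζ ⬝ᵥ w) + β⁻¹ * (w ⬝ᵥ w) := by
      simp only [sub_dotProduct, dotProduct_sub, smul_dotProduct, dotProduct_smul, smul_eq_mul,
        dotProduct_comm w ζ]
      field_simp
      ring
    linarith

theorem posSemidef_conj_transpose {P : Matrix k k ℝ} (hP : P.PosSemidef) (Z : Matrix k n ℝ) :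
    (Zᵀ * P * Z).PosSemidef := by
  simpa [conjTranspose_eq_transpose_of_trivial] using hP.conjTranspose_mul_mul_same Z

theorem posSemidef_transpose_mul_self (Z : Matrix k n ℝ) : (Zᵀ * Z).PosSemidef := by
  simpa [conjTranspose_eq_transpose_of_trivial] using posSemidef_conjTranspose_mul_self Z

/-- The output and perturbation terms of the Riccati expression are nonnegative, so P satisfies a
Lyapunov inequality for F. Hence modifications of P need only preserve the Riccati inequality. -/
theorem posSemidef_of_isStorage [DecidableEq n] {F : Matrix n n ℝ} {R : Matrix n q ℝ}
    {C : Matrix p n ℝ} {α β : ℝ} (hα : 0 < α) (hβ : 0 < β) (hF : IsHurwitz F)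
    {P : Matrix n n ℝ} (hP : Pᵀ = P) (h : (-(riccati F R C α β P)).PosSemidef) :
    P.PosSemidef := by
  refine posSemidef_of_lyapunov hF hP ?_
  have h1 := (posSemidef_transpose_mul_self C).smul hα.le
  have h2 := (posSemidef_transpose_mul_self (Rᵀ * P)).smul (inv_pos.2 hβ).le
  convert (h.add h1).add h2 using 1
  simp only [riccati, transpose_mul, transpose_transpose, hP, Matrix.mul_assoc]
  abel

/-- The sum of the absolute values of the entries bounds the form of N. This is used to absorb a
term of second order in ε. -/
theorem exists_pos_smul_sub [DecidableEq k] {c : ℝ} (hc : 0 < c) {N : Matrix k k ℝ}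
    (hN : Nᵀ = N) : ∃ ε : ℝ, 0 < ε ∧ (c • (1 : Matrix k k ℝ) - ε • N).PosSemidef := by
  set s := ∑ i, ∑ j, |N i j| with hs
  have hs0 : 0 ≤ s := Finset.sum_nonneg fun i _ => Finset.sum_nonneg fun j _ => abs_nonneg _
  refine ⟨c / (s + 1), by positivity, (posSemidef_real_iff _).2 ⟨by simp [hN], fun x => ?_⟩⟩
  have hx : ∀ i, x i ^ 2 ≤ x ⬝ᵥ x := fun i => by
    rw [dotProduct]
    exact (pow_two (x i)).le.trans
      (Finset.single_le_sum (f := fun i => x i * x i) (fun j _ => mul_self_nonneg _)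
        (Finset.mem_univ i))
  have hb : x ⬝ᵥ (N *ᵥ x) ≤ s * (x ⬝ᵥ x) := by
    have e : x ⬝ᵥ (N *ᵥ x) = ∑ i, ∑ j, x i * (N i j * x j) := by
      simp only [mulVec, dotProduct, Finset.mul_sum]
    rw [e, hs, Finset.sum_mul]
    refine Finset.sum_le_sum fun i _ => ?_
    rw [Finset.sum_mul]
    refine Finset.sum_le_sum fun j _ => ?_
    have h1 : x i * (N i j * x j) = N i j * (x i * x j) := by ring
    rw [h1]
    refine (le_abs_self _).trans ?_
    rw [abs_mul]
    refine mul_le_mul_of_nonneg_left ?_ (abs_nonneg _)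
    rw [abs_le]
    constructor <;> nlinarith [hx i, hx j, sq_nonneg (x i + x j), sq_nonneg (x i - x j)]
  have hxx : 0 ≤ x ⬝ᵥ x := by simpa using dotProduct_star_self_nonneg x
  simp only [sub_mulVec, smul_mulVec, one_mulVec, dotProduct_sub, dotProduct_smul, smul_eq_mul]
  have h2 : c / (s + 1) * (x ⬝ᵥ (N *ᵥ x)) ≤ c / (s + 1) * (s * (x ⬝ᵥ x)) :=
    mul_le_mul_of_nonneg_left hb (by positivity)
  have h3 : c / (s + 1) * (s * (x ⬝ᵥ x)) ≤ c * (x ⬝ᵥ x) := by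
    rw [div_mul_eq_mul_div, div_le_iff₀ (by positivity)]
    nlinarith [mul_nonneg hc.le hxx]
  linarith

/-- A left invariant subspace of the worst case closed loop yields new solutions of the Riccati
inequality. -/
theorem exists_perturbed_storage [DecidableEq k] {F : Matrix n n ℝ} {R : Matrix n q ℝ}
    {C : Matrix p n ℝ} {α β : ℝ} {P : Matrix n n ℝ} (hP : Pᵀ = P)
    (h : (-(riccati F R C α β P)).PosSemidef) {Z : Matrix k n ℝ} {H Y : Matrix k k ℝ}
    (hZ : Z * worstCase F R β P = H * Z) (hY : Yᵀ = Y) {c : ℝ} (hc : 0 < c)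
    (hH : Hᵀ * Y + Y * H = -(c • (1 : Matrix k k ℝ))) :
    ∃ ε : ℝ, 0 < ε ∧ (-(riccati F R C α β (P + ε • (Zᵀ * Y * Z)))).PosSemidef := by
  -- The change of the Riccati expression is -εZᵀ(c - εN)Z, where N comes from its quadratic term.
  -- No sign of Y is required.
  obtain ⟨ε, hε, hN⟩ := exists_pos_smul_sub hc
    (N := β⁻¹ • (Y * Z * R * (Rᵀ * Zᵀ * Y))) (by
      simp only [transpose_smul, transpose_mul, transpose_transpose, hY, Matrix.mul_assoc])
  refine ⟨ε, hε, ?_⟩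
  convert h.add ((posSemidef_conj_transpose hN Z).smul hε.le) using 1
  have hZT : (worstCase F R β P)ᵀ * Zᵀ = Zᵀ * Hᵀ := by
    rw [← transpose_mul, hZ, transpose_mul]
  have e1 : Fᵀ * (Zᵀ * Y * Z) + β⁻¹ • (P * R * (Rᵀ * (Zᵀ * Y * Z))) = Zᵀ * (Hᵀ * Y) * Z := by
    have : (worstCase F R β P)ᵀ * Zᵀ * (Y * Z) = Zᵀ * Hᵀ * (Y * Z) := by rw [hZT]
    simpa [worstCase, hP, Matrix.add_mul, Matrix.mul_assoc] using this
  have e2 : (Zᵀ * Y * Z) * F + β⁻¹ • (Zᵀ * Y * Z * R * (Rᵀ * P)) = Zᵀ * (Y * H) * Z := by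
    have : Zᵀ * Y * (Z * worstCase F R β P) = Zᵀ * Y * (H * Z) := by rw [hZ]
    simpa [worstCase, Matrix.mul_add, Matrix.mul_assoc] using this
  have e3 : Zᵀ * (Hᵀ * Y) * Z + Zᵀ * (Y * H) * Z = -(c • (Zᵀ * Z)) := by
    rw [← Matrix.add_mul, ← Matrix.mul_add, hH]; simp
  have e4 : riccati F R C α β (P + ε • (Zᵀ * Y * Z)) = riccati F R C α β P +
      ε • ((Fᵀ * (Zᵀ * Y * Z) + β⁻¹ • (P * R * (Rᵀ * (Zᵀ * Y * Z)))) +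
        ((Zᵀ * Y * Z) * F + β⁻¹ • (Zᵀ * Y * Z * R * (Rᵀ * P)))) +
      (ε * ε * β⁻¹) • (Zᵀ * Y * Z * R * (Rᵀ * (Zᵀ * Y * Z))) := by
    simp only [riccati, Matrix.mul_add, Matrix.add_mul, Matrix.mul_smul, Matrix.smul_mul]
    module
  rw [e4, e1, e2, e3]
  simp only [Matrix.mul_sub, Matrix.sub_mul, Matrix.mul_smul, Matrix.smul_mul, Matrix.mul_one,
    Matrix.mul_assoc]
  module

theorem mulVec_eq_zero_of_posSemidef {P : Matrix n n ℝ} (hP : P.PosSemidef) {x : n → ℝ}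
    (hx : x ⬝ᵥ (P *ᵥ x) = 0) : P *ᵥ x = 0 :=
  (hP.dotProduct_mulVec_zero_iff x).1 (by simpa using hx)

end Riccati

/-! ### Storage matrices of minimal trace -/

section Minimal

variable {n p q : Type*} [Fintype n] [DecidableEq n] [Fintype p] [Fintype q]

/-- Testing with eᵢ ± eⱼ bounds every entry by the trace. -/
theorem isCompact_posSemidef_trace_le (c : ℝ) :
    IsCompact {P : Matrix n n ℝ | P.PosSemidef ∧ P.trace ≤ c} := by
  have hentry : ∀ P : Matrix n n ℝ, P.PosSemidef → ∀ i j, |P i j| ≤ P.trace := by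
    intro P hP i j
    obtain ⟨hs, hp⟩ := (posSemidef_real_iff P).1 hP
    have hd : ∀ i, P i i ≤ P.trace := fun i =>
      Finset.single_le_sum (f := fun i => P i i) (fun i _ => hP.diag_nonneg) (Finset.mem_univ i)
    have hsym : P j i = P i j := congrFun (congrFun hs i) j
    have h1 := hp (Pi.single i 1 + Pi.single j 1)
    have h2 := hp (Pi.single i 1 - Pi.single j 1)
    simp only [mulVec_add, mulVec_sub, dotProduct_add, dotProduct_sub, add_dotProduct,
      sub_dotProduct, mulVec_single_one, single_one_dotProduct, col_apply] at h1 h2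
    rw [hsym] at h1 h2
    rw [abs_le]
    constructor <;> linarith [hd i, hd j]
  have hsub : {P : Matrix n n ℝ | P.PosSemidef ∧ P.trace ≤ c} ⊆
      Set.pi Set.univ fun _ => Set.pi Set.univ fun _ => Set.Icc (-c) c := by
    rintro P ⟨hP, hc⟩ i - j -
    exact abs_le.1 ((hentry P hP i j).trans hc)
  refine IsCompact.of_isClosed_subset
    (isCompact_univ_pi fun _ => isCompact_univ_pi fun _ => isCompact_Icc) ?_ hsub
  have : {P : Matrix n n ℝ | P.PosSemidef ∧ P.trace ≤ c} =
      {P | Pᵀ = P} ∩ (⋂ x : n → ℝ, {P | 0 ≤ x ⬝ᵥ (P *ᵥ x)}) ∩ {P | P.trace ≤ c} := by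
    ext P; simp [posSemidef_real_iff]
  rw [this]
  refine ((isClosed_eq (by fun_prop) (by fun_prop)).inter (isClosed_iInter fun x => ?_)).inter ?_
  · exact isClosed_le (by fun_prop) (by fun_prop)
  · exact isClosed_le (by fun_prop) (by fun_prop)

theorem isClosed_riccati {n p q : Type*} [Fintype n] [Fintype p] [Fintype q] (F : Matrix n n ℝ) (R : Matrix n q ℝ) (C : Matrix p n ℝ) (α β : ℝ) :
    IsClosed {P : Matrix n n ℝ | (-(riccati F R C α β P)).PosSemidef} := by
  have hc : Continuous (riccati F R C α β) := by unfold riccati; fun_prop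
  have hset : {P : Matrix n n ℝ | (-(riccati F R C α β P)).PosSemidef} =
      {P | (-(riccati F R C α β P))ᵀ = -(riccati F R C α β P)} ∩
        ⋂ x : n → ℝ, {P | 0 ≤ x ⬝ᵥ ((-(riccati F R C α β P)) *ᵥ x)} := by
    ext P; simp [posSemidef_real_iff]
  rw [hset]
  refine (isClosed_eq ?_ ?_).inter (isClosed_iInter fun x => isClosed_le ?_ ?_) <;> fun_prop

/-- A storage matrix of minimal trace: the worst case closed loop has no eigenvalue in the open
right half plane. -/
theorem exists_minimal_storage {F : Matrix n n ℝ} {R : Matrix n q ℝ} {C : Matrix p n ℝ} {α β : ℝ}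
    (hα : 0 < α) (hβ : 0 < β) (hF : IsHurwitz F) {P₀ : Matrix n n ℝ} (hP₀ : P₀ᵀ = P₀)
    (h₀ : (-(riccati F R C α β P₀)).PosSemidef) :
    ∃ P : Matrix n n ℝ, Pᵀ = P ∧ (-(riccati F R C α β P)).PosSemidef ∧
      ∀ μ ∈ spectrum ℂ ((worstCase F R β P).map (algebraMap ℝ ℂ)), μ.re ≤ 0 := by
  have hK := (isCompact_posSemidef_trace_le (n := n) P₀.trace).inter_right
    (isClosed_riccati F R C α β)
  obtain ⟨P, ⟨⟨hP, hPt⟩, hPr⟩, hmin⟩ := hK.exists_isMinOn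
    ⟨P₀, ⟨posSemidef_of_isStorage hα hβ hF hP₀ h₀, le_rfl⟩, h₀⟩
    (f := fun P : Matrix n n ℝ => P.trace) (by fun_prop)
  have hPs := ((posSemidef_real_iff P).1 hP).1
  refine ⟨P, hPs, hPr, fun μ hμ => ?_⟩
  by_contra! hre
  obtain ⟨v, hv, hvμ⟩ := (mem_spectrum_iff_exists_mulVec _ _).1
    ((mem_spectrum_transpose_map_iff _ _).2 hμ)
  obtain ⟨ha, hb⟩ := mulVec_re_im_of_eigenvector hvμ
  set a : n → ℝ := fun j => (v j).re with hadef
  set b : n → ℝ := fun j => (v j).im with hbdef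
  have hab : ¬(a = 0 ∧ b = 0) := by
    rintro ⟨h1, h2⟩
    exact hv (funext fun j => Complex.ext (congrFun h1 j) (congrFun h2 j))
  -- Real and imaginary parts of an unstable left eigenvector span a left invariant subspace on
  -- which H acts, with H + Hᵀ = 2 Re μ. So Y = -1 is allowed, and subtracting εZᵀZ from P keeps the
  -- Riccati inequality while lowering the trace.
  obtain ⟨ε, hε, hnew⟩ := exists_perturbed_storage hPs hPr (Z := Matrix.of ![a, b])
    (H := !![μ.re, -μ.im; μ.im, μ.re]) (Y := -1) (c := 2 * μ.re) (by
      ext i j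
      have hW : ∀ w : n → ℝ, (∑ x, w x * worstCase F R β P x j)
          = ((worstCase F R β P)ᵀ *ᵥ w) j := by
        intro w; simp [mulVec, dotProduct, mul_comm]
      fin_cases i
      · simp [Matrix.mul_apply, hW, ha]; ring
      · simp [Matrix.mul_apply, hW, hb]) (by simp) (by positivity) (by
      ext i j
      fin_cases i <;> fin_cases j <;> simp <;> ring)
  set Z : Matrix (Fin 2) n ℝ := Matrix.of ![a, b] with hZ
  have hsym : (P + ε • (Zᵀ * (-1 : Matrix (Fin 2) (Fin 2) ℝ) * Z))ᵀ = P + ε • (Zᵀ * (-1 : Matrix (Fin 2) (Fin 2) ℝ) * Z) := by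
    simp [hPs]
  have htr : 0 < (Zᵀ * Z).trace := by
    refine lt_of_le_of_ne (posSemidef_transpose_mul_self Z).trace_nonneg fun h0 => hab ?_
    have hz := trace_conjTranspose_mul_self_eq_zero_iff (A := Z)
    rw [conjTranspose_eq_transpose_of_trivial] at hz
    have hz0 := hz.1 h0.symm
    exact ⟨congrFun hz0 0, congrFun hz0 1⟩
  have hlt : (P + ε • (Zᵀ * (-1 : Matrix (Fin 2) (Fin 2) ℝ) * Z)).trace < P.trace := by
    simp only [Matrix.mul_neg, Matrix.mul_one, Matrix.neg_mul, trace_add, trace_smul, trace_neg,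
      smul_eq_mul]
    nlinarith [mul_pos hε htr]
  exact absurd (hmin ⟨⟨posSemidef_of_isStorage hα hβ hF hsym hnew, hlt.le.trans hPt⟩, hnew⟩)
    (not_le.2 hlt)

end Minimal

/-! ### Adding an autonomous decaying input -/

section Cascade

variable {n k p q : Type*} [Fintype n] [DecidableEq n] [Fintype k] [DecidableEq k] [Fintype p]
  [Fintype q]

/-- The dissipation inequality survives an autonomous exponentially decaying input. -/
theorem exists_cascade_storage {F : Matrix n n ℝ} {R : Matrix n q ℝ} {C : Matrix p n ℝ} {α β : ℝ}
    (hα : 0 < α) (hβ : 0 < β) (hF : IsHurwitz F) {P₀ : Matrix n n ℝ} (hP₀ : P₀ᵀ = P₀)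
    (h₀ : (-(riccati F R C α β P₀)).PosSemidef) (G : Matrix n k ℝ) {E : Matrix k k ℝ}
    (hE : IsHurwitz E) :
    ∃ P : Matrix (n ⊕ k) (n ⊕ k) ℝ, Pᵀ = P ∧
      (-(riccati (fromBlocks F G 0 E) (fromRows R (0 : Matrix k q ℝ))
        (fromCols C (0 : Matrix p k ℝ)) α β P)).PosSemidef := by
  obtain ⟨P, hP, hPr, hspec⟩ := exists_minimal_storage hα hβ hF hP₀ h₀
  -- X is the off-diagonal block of the new storage matrix; the equation says that the off-diagonal
  -- Riccati block vanishes.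
  obtain ⟨X, hX⟩ := exists_sylvester (IsHurwitz.sylvester_cond hspec hE) (-(P * G))
  -- Y is the lower diagonal block, with right-hand side chosen so that the lower Riccati block
  -- vanishes too. No sign of Y matters here.
  obtain ⟨Y, hY, hYe⟩ := exists_lyapunov hE
    (Q := Gᵀ * X + Xᵀ * G + β⁻¹ • (Xᵀ * R * (Rᵀ * X))) (by
      simp only [transpose_add, transpose_mul, transpose_smul, transpose_transpose,
        Matrix.mul_assoc]
      abel)
  have hX' : Fᵀ * X + P * G + X * E + β⁻¹ • (P * R * (Rᵀ * X)) = 0 := by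
    rw [worstCase] at hX
    simp only [transpose_add, transpose_smul, transpose_mul, transpose_transpose, hP,
      Matrix.add_mul, Matrix.smul_mul, Matrix.mul_assoc] at hX
    have : Fᵀ * X + P * G + X * E + β⁻¹ • (P * R * (Rᵀ * X)) =
      (Fᵀ * X + β⁻¹ • (P * (R * (Rᵀ * X))) + X * E) + P * G := by
        rw [Matrix.mul_assoc]; abel
    rw [this, hX, neg_add_cancel]
  have hXT := congrArg transpose hX'
  simp only [transpose_add, transpose_mul, transpose_smul, transpose_transpose, hP,
    transpose_zero] at hXT
  have hsym : (fromBlocks P X Xᵀ Y)ᵀ = fromBlocks P X Xᵀ Y := by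
    rw [fromBlocks_transpose, hP, hY, transpose_transpose]
  refine ⟨fromBlocks P X Xᵀ Y, hsym, ?_⟩
  have hric : riccati (fromBlocks F G 0 E) (fromRows R (0 : Matrix k q ℝ))
      (fromCols C (0 : Matrix p k ℝ)) α β (fromBlocks P X Xᵀ Y) =
      fromBlocks (riccati F R C α β P) 0 0 0 := by
    have eC : (fromCols C (0 : Matrix p k ℝ))ᵀ * fromCols C (0 : Matrix p k ℝ) =
        fromBlocks (Cᵀ * C) 0 0 0 := by
      rw [transpose_fromCols, fromRows_mul_fromCols]; simp
    have eR : fromBlocks P X Xᵀ Y * fromRows R (0 : Matrix k q ℝ) *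
        ((fromRows R (0 : Matrix k q ℝ))ᵀ * fromBlocks P X Xᵀ Y) =
        fromBlocks (P * R * (Rᵀ * P)) (P * R * (Rᵀ * X)) (Xᵀ * R * (Rᵀ * P))
          (Xᵀ * R * (Rᵀ * X)) := by
      rw [fromBlocks_mul_fromRows, transpose_fromRows, fromCols_mul_fromBlocks,
        fromRows_mul_fromCols]
      simp
    rw [riccati, eC, eR, fromBlocks_transpose, fromBlocks_multiply, fromBlocks_multiply,
      fromBlocks_smul, fromBlocks_smul, fromBlocks_add, fromBlocks_add, fromBlocks_add, riccati]
    congr 1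
    · simp
    · simp only [smul_zero, add_zero, Matrix.zero_mul, transpose_zero]
      rw [← hX']; abel
    · simp only [smul_zero, add_zero, Matrix.mul_zero]
      rw [← hXT]; abel
    · have : Gᵀ * X + Eᵀ * Y + (Xᵀ * G + Y * E) =
        Gᵀ * X + Xᵀ * G + (Eᵀ * Y + Y * E) := by abel
      simp only [smul_zero, add_zero, this, hYe]
      abel
  rw [hric]
  obtain ⟨hs, hp⟩ := (posSemidef_real_iff _).1 hPr
  rw [posSemidef_real_iff]
  constructor
  · rw [transpose_neg, fromBlocks_transpose, riccati_transpose hP]; simp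
  · intro x
    have := hp (x ∘ Sum.inl)
    rw [neg_mulVec, dotProduct_neg] at this ⊢
    rw [fromBlocks_mulVec]
    simpa [dotProduct, Fintype.sum_sum_type] using this

end Cascade

/-! ### From semidefinite to definite storage matrices -/

section PosDef

variable {n p q : Type*} [Fintype n] [DecidableEq n] [Fintype p] [Fintype q]

/-- Sort the prime factors of a according to whether they divide b; N counts those that do. -/
theorem exists_coprime_splitting {k : Type*} [Field k] (a b : Polynomial k) (ha : a ≠ 0) :
    ∃ (f g : Polynomial k) (N : ℕ), a = f * g ∧ f ∣ b ^ N ∧ IsCoprime g b := by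
  induction a using UniqueFactorizationMonoid.induction_on_prime with
  | h₁ => exact absurd rfl ha
  | h₂ x hx => exact ⟨1, x, 0, by simp, by simp, 
      isCoprime_one_left.of_isCoprime_of_dvd_left (isUnit_iff_dvd_one.1 hx)⟩
  | h₃ a π ha0 hπ ih =>
    obtain ⟨f, g, N, rfl, hf, hg⟩ := ih ha0
    by_cases hb : π ∣ b
    · exact ⟨π * f, g, N + 1, by ring, by rw [pow_succ']; exact mul_dvd_mul hb hf, hg⟩
    · exact ⟨f, π * g, N, by ring, hf,
        ((hπ.irreducible.coprime_iff_not_dvd).2 hb).mul_left hg⟩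

/-- A Hurwitz system with a positive semidefinite storage matrix has a positive definite one. -/
theorem exists_posDef_storage {F : Matrix n n ℝ} {R : Matrix n q ℝ} {C : Matrix p n ℝ} {α β : ℝ}
    (hα : 0 < α) (hβ : 0 < β) (hF : IsHurwitz F) {P : Matrix n n ℝ} (hP : Pᵀ = P)
    (h : (-(riccati F R C α β P)).PosSemidef) :
    ∃ P' : Matrix n n ℝ, P'.PosDef ∧ (-(riccati F R C α β P')).PosSemidef := by
  have hPp := posSemidef_of_isStorage hα hβ hF hP h
  set W := worstCase F R β P with hW
  obtain ⟨f, g, N, hfg, hf, hg⟩ := exists_coprime_splitting W.charpoly F.charpoly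
    (charpoly_monic W).ne_zero
  obtain ⟨u, v, huv⟩ : IsCoprime f g := by
    obtain ⟨r, hr⟩ := hf
    exact ((hg.pow_right (n := N)).symm.of_isCoprime_of_dvd_left ⟨r, hr⟩)
  -- S and T are complementary spectral projections of W: T belongs to the eigenvalues shared with
  -- F, S to the others.
  set S := Polynomial.aeval W (u * f) with hS
  set T := Polynomial.aeval W (v * g) with hT
  have hsum : S + T = 1 := by rw [hS, hT, ← map_add, huv, map_one]
  have hST : S * T = 0 := by
    rw [hS, hT, ← map_mul, show u * f * (v * g) = u * v * W.charpoly by rw [hfg]; ring, map_mul,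
      aeval_self_charpoly, mul_zero]
  -- a shift that moves the remaining eigenvalues to the left half plane
  obtain ⟨s, hs⟩ : ∃ s : ℝ, ∀ μ ∈ spectrum ℂ (W.map (algebraMap ℝ ℂ)), μ.re < s := by
    obtain ⟨s, hs⟩ := ((Matrix.finite_spectrum (W.map (algebraMap ℝ ℂ))).image
      Complex.re).bddAbove
    exact ⟨s + 1, fun μ hμ => (hs ⟨μ, hμ, rfl⟩).trans_lt (lt_add_one s)⟩
  -- On roots of f the shift does nothing and they are eigenvalues of F; on roots of g the Bézout
  -- identity gives uf = 1, so z moves to z - s.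
  have hH : IsHurwitz (W - s • S) := by
    set r : Polynomial ℝ := Polynomial.X - Polynomial.C s * (u * f) with hr
    have hWr : (W - s • S).map (algebraMap ℝ ℂ) =
        Polynomial.aeval (W.map (algebraMap ℝ ℂ)) (r.map (algebraMap ℝ ℂ)) := by
      have e : W - s • S = Polynomial.aeval W r := by
        simp [hr, hS, Algebra.algebraMap_eq_smul_one]
      rw [e, Polynomial.aeval_map_algebraMap]
      exact (Polynomial.aeval_algHom_apply (Algebra.ofId ℝ ℂ).mapMatrix W r).symm
    intro μ hμ
    obtain ⟨y, hy, -⟩ := (mem_spectrum_iff_exists_mulVec _ _).1 hμ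
    obtain ⟨i, -⟩ := Function.ne_iff.1 hy
    have : Nonempty n := ⟨i⟩
    rw [hWr, spectrum.map_polynomial_aeval_of_nonempty _ _
      (spectrum.nonempty_of_isAlgClosed_of_finiteDimensional ℂ _)] at hμ
    obtain ⟨z, hz, rfl⟩ := hμ
    have hroot := (aeval_charpoly_eq_zero_iff W z).2 hz
    rw [hfg, map_mul, mul_eq_zero] at hroot
    have hval : Polynomial.eval z (r.map (algebraMap ℝ ℂ)) =
        z - s * (Polynomial.aeval z u * Polynomial.aeval z f) := by
      rw [Polynomial.eval_map_algebraMap, hr]; simp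
    dsimp only
    rw [hval]
    rcases hroot with h0 | h0
    · rw [h0, mul_zero, mul_zero, sub_zero]
      refine hF z ((aeval_charpoly_eq_zero_iff F z).1 ?_)
      obtain ⟨t, ht⟩ := hf
      have := congrArg (Polynomial.aeval z) ht
      rw [map_pow, map_mul, h0, zero_mul] at this
      exact eq_zero_of_pow_eq_zero this
    · have := congrArg (Polynomial.aeval z) huv
      rw [map_add, map_mul, map_mul, h0, mul_zero, add_zero, map_one] at this
      rw [this, mul_one, Complex.sub_re, Complex.ofReal_re]
      linarith [hs z hz]
  have hTH : T * W = (W - s • S) * T := by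
    have : T * W = W * T := by
      have := congrArg (Polynomial.aeval W) (mul_comm (v * g) Polynomial.X)
      simpa only [map_mul, Polynomial.aeval_X, ← hT] using this
    rw [Matrix.sub_mul, Matrix.smul_mul, hST, smul_zero, sub_zero, this]
  obtain ⟨Y, hY, hYe⟩ := exists_lyapunov hH (Q := (1 : ℝ) • 1) (by simp)
  obtain ⟨ε, hε, hnew⟩ := exists_perturbed_storage hP h hTH hY one_pos hYe
  have hYp : Y.PosSemidef := posSemidef_of_lyapunov hH hY (by
    rw [hYe, neg_neg, one_smul]; exact PosSemidef.one)
  have hYker : ∀ y, Y *ᵥ y = 0 → y = 0 := by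
    intro y hy
    have h1 := congrArg (fun M => y ⬝ᵥ (M *ᵥ y)) hYe
    simp only [add_mulVec, ← mulVec_mulVec, hy, mulVec_zero, zero_add, one_smul, neg_mulVec,
      one_mulVec, dotProduct_neg, dotProduct_mulVec_of_symm hY, zero_dotProduct, zero_eq_neg] at h1
    exact dotProduct_self_eq_zero.1 h1
  -- the kernel of `P` is invariant
  have hker : ∀ x, P *ᵥ x = 0 → P *ᵥ (F *ᵥ x) = 0 := by
    intro x hx
    have h1 : x ⬝ᵥ ((-(riccati F R C α β P)) *ᵥ x) = -(α * ((C *ᵥ x) ⬝ᵥ (C *ᵥ x))) := by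
      rw [neg_mulVec, dotProduct_neg, riccati_form hP]; simp [hx]
    have h2 := ((posSemidef_real_iff _).1 h).2 x
    have h3 : 0 ≤ α * ((C *ᵥ x) ⬝ᵥ (C *ᵥ x)) :=
      mul_nonneg hα.le (by simpa using dotProduct_star_self_nonneg (C *ᵥ x))
    have h4 : α * ((C *ᵥ x) ⬝ᵥ (C *ᵥ x)) = 0 := by linarith
    have h5 : C *ᵥ x = 0 := dotProduct_self_eq_zero.1 ((mul_eq_zero.1 h4).resolve_left hα.ne')
    have h6 := mulVec_eq_zero_of_posSemidef h (x := x) (by rw [h1, h4, neg_zero])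
    simpa [riccati, add_mulVec, smul_mulVec, ← mulVec_mulVec, hx, h5, neg_mulVec] using h6
  have hpow : ∀ x, P *ᵥ x = 0 → ∀ k : ℕ, W ^ k *ᵥ x = F ^ k *ᵥ x ∧ P *ᵥ (F ^ k *ᵥ x) = 0 := by
    intro x hx k
    induction k with
    | zero => simpa using hx
    | succ k ih =>
      rw [pow_succ', pow_succ', ← mulVec_mulVec, ← mulVec_mulVec, ih.1]
      refine ⟨?_, hker _ ih.2⟩
      rw [hW, worstCase, add_mulVec, smul_mulVec, ← mulVec_mulVec, ← mulVec_mulVec, ih.2]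
      simp
  have haev : ∀ x, P *ᵥ x = 0 → ∀ r : Polynomial ℝ,
      Polynomial.aeval W r *ᵥ x = Polynomial.aeval F r *ᵥ x := by
    intro x hx r
    induction r using Polynomial.induction_on' with
    | add a b ha hb => simp only [map_add, add_mulVec, ha, hb]
    | monomial k a =>
      simp only [Polynomial.aeval_monomial, Algebra.algebraMap_eq_smul_one, smul_mul_assoc,
        one_mul, smul_mulVec, (hpow x hx k).1]
  -- If Tx = 0 then g(W)x = 0. On ker P polynomials in W and F agree, so g(F)x = 0, and g is coprime
  -- to the characteristic polynomial of F. Hence adding εTᵀYT with Y definite makes P definite.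
  have hTker : ∀ x, P *ᵥ x = 0 → T *ᵥ x = 0 → x = 0 := by
    intro x hx hTx
    obtain ⟨a, b, hab⟩ := hg
    have h1 : S *ᵥ x = x := by
      have := congrArg (fun M => M *ᵥ x) hsum
      simpa [add_mulVec, hTx] using this
    have h2 : Polynomial.aeval W g *ᵥ x = 0 := by
      rw [← h1, mulVec_mulVec, hS, ← map_mul,
        show g * (u * f) = u * W.charpoly by rw [hfg]; ring, map_mul, aeval_self_charpoly,
        mul_zero, zero_mulVec]
    have h3 : Polynomial.aeval F g *ᵥ x = 0 := by rw [← haev x hx, h2]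
    have h4 := congrArg (fun r => Polynomial.aeval F r *ᵥ x) hab
    simpa [add_mulVec, ← mulVec_mulVec, h3, aeval_self_charpoly] using h4.symm
  refine ⟨_, ?_, hnew⟩
  have hTY := (posSemidef_conj_transpose hYp T)
  refine PosDef.of_dotProduct_mulVec_pos (hPp.add (hTY.smul hε.le)).isHermitian fun x hx => ?_
  have h1 := ((posSemidef_real_iff _).1 hPp).2 x
  have h2 := ((posSemidef_real_iff _).1 hTY).2 x
  simp only [star_trivial, add_mulVec, smul_mulVec, dotProduct_add, dotProduct_smul, smul_eq_mul]
  refine lt_of_le_of_ne (add_nonneg h1 (mul_nonneg hε.le h2)) fun h0 => hx ?_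
  have h3 := mul_nonneg hε.le h2
  have h4 : ε * (x ⬝ᵥ ((Tᵀ * Y * T) *ᵥ x)) = 0 := by linarith
  have h5 := (mul_eq_zero.1 h4).resolve_left hε.ne'
  rw [← mulVec_mulVec, ← mulVec_mulVec, dotProduct_transpose_mulVec] at h5
  exact hTker x (mulVec_eq_zero_of_posSemidef hPp (by linarith))
    (hYker _ (mulVec_eq_zero_of_posSemidef hYp h5))

end PosDef

/-! ### The closed loop with the observer -/

section Observer

theorem map_sub_mul {k l o : Type*} [Fintype o] (A : Matrix k l ℝ) (L : Matrix k o ℝ)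
    (C : Matrix o l ℝ) : (A - L * C).map (algebraMap ℝ ℂ) =
      A.map (algebraMap ℝ ℂ) - L.map (algebraMap ℝ ℂ) * C.map (algebraMap ℝ ℂ) := by
  rw [← Matrix.map_mul, Matrix.map_sub _ (map_sub _)]

/-- Storage functions pull back along a linear map that carries trajectories to trajectories with
the same output. T need not be injective, so definiteness can be lost. -/
theorem riccati_intertwine {n k p q : Type*} [Fintype n] [Fintype k] [Fintype p] [Fintype q]
    {F : Matrix n n ℝ} {R : Matrix n q ℝ} {C : Matrix p n ℝ} {F' : Matrix k k ℝ}
    {R' : Matrix k q ℝ} {T : Matrix n k ℝ} (hF : T * F' = F * T) (hR : T * R' = R) (α β : ℝ)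
    (P : Matrix n n ℝ) :
    riccati F' R' (C * T) α β (Tᵀ * P * T) = Tᵀ * riccati F R C α β P * T := by
  have hFT : F'ᵀ * Tᵀ = Tᵀ * Fᵀ := by rw [← transpose_mul, hF, transpose_mul]
  have hRT : R'ᵀ * Tᵀ = Rᵀ := by rw [← transpose_mul, hR]
  have e1 : F'ᵀ * (Tᵀ * P * T) = Tᵀ * (Fᵀ * P) * T := by
    rw [Matrix.mul_assoc Tᵀ, ← Matrix.mul_assoc, hFT]; simp only [Matrix.mul_assoc]
  have e2 : Tᵀ * P * T * F' = Tᵀ * (P * F) * T := by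
    rw [Matrix.mul_assoc _ T, hF]; simp only [Matrix.mul_assoc]
  have e3 : Tᵀ * P * T * R' * (R'ᵀ * (Tᵀ * P * T)) = Tᵀ * (P * R * (Rᵀ * P)) * T := by
    rw [Matrix.mul_assoc _ T, hR, Matrix.mul_assoc Tᵀ P T, ← Matrix.mul_assoc R'ᵀ, hRT]
    simp only [Matrix.mul_assoc]
  rw [riccati, e1, e2, e3, riccati]
  simp only [transpose_mul, Matrix.mul_add, Matrix.add_mul, Matrix.mul_smul, Matrix.smul_mul,
    Matrix.mul_assoc]

variable {n m p q z : Type*} [Fintype n] [DecidableEq n] [Fintype m] [Fintype p] [Fintype q]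
  [Fintype z] [DecidableEq z]

theorem fromBlocks_map_mulVec {k l o r : Type*} [Fintype l] [Fintype r] (A : Matrix k l ℝ)
    (B : Matrix k r ℝ) (C : Matrix o l ℝ) (D : Matrix o r ℝ) (x : l ⊕ r → ℂ) :
    (fromBlocks A B C D).map (algebraMap ℝ ℂ) *ᵥ x =
      Sum.elim (A.map (algebraMap ℝ ℂ) *ᵥ (x ∘ Sum.inl) + B.map (algebraMap ℝ ℂ) *ᵥ (x ∘ Sum.inr))
        (C.map (algebraMap ℝ ℂ) *ᵥ (x ∘ Sum.inl) + D.map (algebraMap ℝ ℂ) *ᵥ (x ∘ Sum.inr)) := by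
  rw [fromBlocks_map, fromBlocks_mulVec]

theorem isHurwitz_fromBlocks_zero₁₂ {A : Matrix n n ℝ} {C : Matrix z n ℝ} {D : Matrix z z ℝ}
    (hA : IsHurwitz A) (hD : IsHurwitz D) : IsHurwitz (fromBlocks A 0 C D) := by
  rw [isHurwitz_iff] at *
  intro μ v hv h
  rw [fromBlocks_map_mulVec] at h
  have h1 := congrArg (· ∘ Sum.inl) h
  have h2 := congrArg (· ∘ Sum.inr) h
  simp only [Sum.elim_comp_inl, Sum.elim_comp_inr, Matrix.map_zero _ (map_zero (algebraMap ℝ ℂ)),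
    zero_mulVec, add_zero] at h1 h2
  by_cases hx : v ∘ Sum.inl = 0
  · rw [hx, mulVec_zero, zero_add] at h2
    refine hD μ (v ∘ Sum.inr) (fun h0 => hv ?_) h2
    rw [← Sum.elim_comp_inl_inr v, hx, h0]
    exact Sum.elim_zero_zero
  · exact hA μ _ hx h1

theorem isHurwitz_of_intertwine {k : Type*} [Fintype k] [DecidableEq k] {F : Matrix n n ℝ}
    {F' : Matrix k k ℝ} {T : Matrix n k ℝ} {T' : Matrix k n ℝ} (hF : T * F' = F * T)
    (hT : T' * T = 1) (h : IsHurwitz F) : IsHurwitz F' := by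
  rw [isHurwitz_iff] at *
  intro μ v hv hμ
  have hm : T.map (algebraMap ℝ ℂ) * F'.map (algebraMap ℝ ℂ) =
      F.map (algebraMap ℝ ℂ) * T.map (algebraMap ℝ ℂ) := by
    rw [← Matrix.map_mul, hF, Matrix.map_mul]
  have hm' : T'.map (algebraMap ℝ ℂ) * T.map (algebraMap ℝ ℂ) = 1 := by
    rw [← Matrix.map_mul, hT, Matrix.map_one _ (map_zero _) (map_one _)]
  refine h μ (T.map (algebraMap ℝ ℂ) *ᵥ v) (fun h0 => hv ?_) ?_
  · rw [← one_mulVec v, ← hm', ← mulVec_mulVec, h0, mulVec_zero]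
  · rw [mulVec_mulVec, ← hm, ← mulVec_mulVec, hμ, mulVec_smul]

/-- Separation principle: in the coordinates (x - χ, x) the loop is block triangular with diagonal
blocks A - LC and A + BK. -/
theorem isHurwitz_observerA {n m p q : Type*} [Fintype n] [DecidableEq n] [Fintype m]
    [Fintype p] {S : ControlSystem n m p q} {K : Matrix m n ℝ} {L : Matrix n p ℝ}
    (hK : IsHurwitz (S.A + S.B * K)) (hL : IsHurwitz (S.A - L * S.C)) :
    IsHurwitz (S.observerA K L) := by
  refine isHurwitz_of_intertwine (F := fromBlocks (S.A - L * S.C) 0 (-(S.B * K)) (S.A + S.B * K))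
    (T := fromBlocks 1 (-1) 1 0) (T' := fromBlocks 0 1 (-1) 1) ?_ ?_
    (isHurwitz_fromBlocks_zero₁₂ hL hK)
  · rw [ControlSystem.observerA, fromBlocks_multiply, fromBlocks_multiply]
    congr 1 <;> simp [sub_eq_add_neg]
  · rw [fromBlocks_multiply]
    simp

/-- The dynamic controller for the augmented system preserves the gain of the state feedback. -/
theorem augmented_solvedByOutputFeedback (S : ControlSystem n m p q) (Bplus : Matrix m n ℝ)
    {M : Matrix z z ℝ} (N : Matrix z m ℝ) (Q : Matrix m z ℝ) (hM : IsHurwitz M) {γ : ℝ}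
    {K : Matrix m n ℝ} (hK : S.SolvedByStateFeedback γ K) {L : Matrix (n ⊕ z) p ℝ}
    (hL : IsHurwitz ((S.augmented Bplus M N Q).A - L * (S.augmented Bplus M N Q).C)) :
    (S.augmented Bplus M N Q).SolvedByOutputFeedback γ (fromCols K (-Q)) L := by
  obtain ⟨hF, P₀, hP₀, α, β, hα, hβ, hγ, hst⟩ := hK
  set S' := S.augmented Bplus M N Q with hS'
  have hP₀s := ((posSemidef_real_iff P₀).1 hP₀.posSemidef).1
  have h₀ := (isStorage_iff hβ hP₀s).1 hst
  have hcl : IsHurwitz (S'.A + S'.B * fromCols K (-Q)) := by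
    have : S'.A + S'.B * fromCols K (-Q) = fromBlocks (S.A + S.B * K) 0 (N * K) M := by
      simp only [hS', ControlSystem.augmented, fromRows_mul_fromCols, fromBlocks_add]
      simp
    rw [this]
    exact isHurwitz_fromBlocks_zero₁₂ hF hM
  have hobs := isHurwitz_observerA hcl hL
  refine ⟨hobs, ?_⟩
  obtain ⟨P, hP, hPr⟩ := exists_cascade_storage hα hβ hF hP₀s h₀
    (-(S.B * fromCols K (-Q))) hL
  set J : Matrix n (n ⊕ z) ℝ := fromCols 1 0 with hJ
  -- T sends (col(x, z), χ) to (x, e) with e = col(x, z) - χ; it forgets a common shift of z and its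
  -- estimate.
  set T : Matrix (n ⊕ (n ⊕ z)) ((n ⊕ z) ⊕ (n ⊕ z)) ℝ := fromBlocks J 0 1 (-1) with hT
  have hJA : J * S'.A = (S.A + S.B * K) * J - S.B * fromCols K (-Q) := by
    simp only [hJ, hS', ControlSystem.augmented, fromCols_mul_fromBlocks, mul_fromCols]
    ext i (j | j) <;> simp
  have hJB : J * S'.B = S.B := by
    simp only [hJ, hS', ControlSystem.augmented, fromCols_mul_fromRows]
    simp
  have hJR : J * S'.R = S.R := by
    simp only [hJ, hS', ControlSystem.augmented, fromCols_mul_fromRows]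
    simp
  have hJC : S'.C = S.C * J := by
    simp only [hJ, hS', ControlSystem.augmented, mul_fromCols]
    simp
  have hTF : T * S'.observerA (fromCols K (-Q)) L =
      fromBlocks (S.A + S.B * K) (-(S.B * fromCols K (-Q))) 0 (S'.A - L * S'.C) * T := by
    simp only [hT, ControlSystem.observerA, fromBlocks_multiply, ← Matrix.mul_assoc, hJB, hJA]
    congr 1
    · simp [sub_eq_add_neg]
    · simp
    · simp [sub_eq_add_neg]
    · rw [Matrix.one_mul]
      generalize S'.B * fromCols K (-Q) = G
      simp
  have hTR : T * S'.observerR = fromRows S.R 0 := by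
    simp only [hT, ControlSystem.observerR, fromBlocks_mul_fromRows, hJR]
    simp
  have hTC : S'.observerC =
      (fromCols S.C 0 : Matrix p (n ⊕ (n ⊕ z)) ℝ) * T := by
    simp only [hT, ControlSystem.observerC, fromCols_mul_fromBlocks, hJC]
    simp
  have hnew : (-(riccati (S'.observerA (fromCols K (-Q)) L) S'.observerR S'.observerC α β
      (Tᵀ * P * T))).PosSemidef := by
    rw [hTC, riccati_intertwine hTF hTR]
    simpa using posSemidef_conj_transpose hPr T
  obtain ⟨P', hP', hPr'⟩ := exists_posDef_storage hα hβ hobs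
    (by simp [hP, Matrix.mul_assoc]) hnew
  exact ⟨P', hP', α, β, hα, hβ, hγ,
    (isStorage_iff hβ ((posSemidef_real_iff P').1 hP'.posSemidef).1).2 hPr'⟩

end Observer

/-! ### Detectability and the existence of L -/

section Detectability

variable {n p : Type*} [Fintype n] [DecidableEq n] [Fintype p]

/-- Z replaces C W⁻¹ when W is singular: define it on the range of W and extend linearly. -/
theorem exists_mul_eq_of_ker_le {n p : Type*} [Fintype n] [DecidableEq n] {W : Matrix n n ℝ} {C : Matrix p n ℝ}
    (h : ∀ x, W *ᵥ x = 0 → C *ᵥ x = 0) : ∃ Z : Matrix p n ℝ, Z * W = C := by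
  obtain ⟨g, hg⟩ := LinearMap.exists_extend (p := LinearMap.range W.mulVecLin)
    ((LinearMap.ker W.mulVecLin).liftQ C.mulVecLin (fun x hx => h x hx) ∘ₗ
      (W.mulVecLin.quotKerEquivRange.symm : _ →ₗ[ℝ] _))
  refine ⟨LinearMap.toMatrix' g, ?_⟩
  apply Matrix.toLin'.injective
  refine LinearMap.ext fun x => ?_
  have h1 := LinearMap.congr_fun hg (W.mulVecLin.quotKerEquivRange (Submodule.Quotient.mk x))
  simp only [LinearMap.comp_apply, LinearEquiv.coe_coe, LinearEquiv.symm_apply_apply] at h1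
  rw [toLin'_mul, toLin'_toMatrix']
  exact h1

/-- The Hautus criterion for detectability. -/
theorem exists_isHurwitz_sub_mul (A : Matrix n n ℝ) (C : Matrix p n ℝ)
    (h : ∀ (μ : ℂ) (v : n → ℂ), v ≠ 0 → A.map (algebraMap ℝ ℂ) *ᵥ v = μ • v →
      C.map (algebraMap ℝ ℂ) *ᵥ v = 0 → μ.re < 0) :
    ∃ L : Matrix n p ℝ, IsHurwitz (A - L * C) := by
  classical
  obtain ⟨s, hs0, hs⟩ : ∃ s : ℝ, 0 ≤ s ∧
      ∀ μ ∈ spectrum ℂ (A.map (algebraMap ℝ ℂ)), -s < μ.re := by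
    obtain ⟨s, hs⟩ := ((Matrix.finite_spectrum (A.map (algebraMap ℝ ℂ))).image
      Complex.re).bddBelow
    refine ⟨|s| + 1, by positivity, fun μ hμ => ?_⟩
    have := hs ⟨μ, hμ, rfl⟩
    linarith [neg_abs_le s]
  have hshift : IsHurwitz (-A - s • (1 : Matrix n n ℝ)) := by
    rw [isHurwitz_iff]
    intro μ v hv hμ
    have e : (-A - s • (1 : Matrix n n ℝ)).map (algebraMap ℝ ℂ) =
        -(A.map (algebraMap ℝ ℂ)) - (s : ℂ) • 1 := by
      ext i j
      by_cases hij : i = j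
      · subst hij; simp
      · simp [hij]
    rw [e, sub_mulVec, neg_mulVec, smul_mulVec, one_mulVec] at hμ
    have := hs (-μ - s) ((mem_spectrum_iff_exists_mulVec _ _).2 ⟨v, hv, by
      rw [sub_smul, neg_smul, ← hμ]; abel⟩)
    simp at this
    linarith
  -- The shift by s makes -A - s Hurwitz, so W is semidefinite. It may be singular, but ker W lies
  -- in ker C.
  obtain ⟨W, hW, hWe⟩ := exists_lyapunov hshift (Q := Cᵀ * C) (by simp)
  have hWp : W.PosSemidef := posSemidef_of_lyapunov hshift hW (by
    rw [hWe, neg_neg]; exact posSemidef_transpose_mul_self C)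
  have hform : ∀ x, 2 * ((A *ᵥ x) ⬝ᵥ (W *ᵥ x)) =
      (C *ᵥ x) ⬝ᵥ (C *ᵥ x) - 2 * s * (x ⬝ᵥ (W *ᵥ x)) := by
    intro x
    have h1 := congrArg (fun M => x ⬝ᵥ (M *ᵥ x)) hWe
    have e : (-A - s • (1 : Matrix n n ℝ)) *ᵥ x = -(A *ᵥ x) - s • x := by
      rw [sub_mulVec, neg_mulVec, smul_mulVec, one_mulVec]
    simp only [add_mulVec, ← mulVec_mulVec, dotProduct_add, dotProduct_transpose_mulVec,
      neg_mulVec, dotProduct_neg, dotProduct_mulVec_of_symm hW x, e] at h1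
    rw [dotProduct_comm (W *ᵥ x)] at h1
    simp only [sub_dotProduct, neg_dotProduct, smul_dotProduct, smul_eq_mul] at h1
    linarith
  obtain ⟨Z, hZ⟩ := exists_mul_eq_of_ker_le (W := W) (C := C) fun x hx => by
    have h1 := hform x
    rw [hx, dotProduct_zero, dotProduct_zero] at h1
    exact dotProduct_self_eq_zero.1 (by linarith)
  -- The gain L = Zᵀ, formally W⁻¹Cᵀ, satisfies LᵀW = C. Along A - LC the form of W then has
  -- derivative -‖Cx‖² - 2s xᵀWx, so an eigenvector with Re μ ≥ 0 lies in ker C and is an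
  -- eigenvector of A, against the hypothesis.
  refine ⟨Zᵀ, (isHurwitz_iff _).2 fun μ v hv hμ => ?_⟩
  obtain ⟨ha, hb⟩ := mulVec_re_im_of_eigenvector hμ
  by_contra! hre
  set a : n → ℝ := fun j => (v j).re with hadef
  set b : n → ℝ := fun j => (v j).im with hbdef
  have hL : ∀ x, ((A - Zᵀ * C) *ᵥ x) ⬝ᵥ (W *ᵥ x) =
      (A *ᵥ x) ⬝ᵥ (W *ᵥ x) - (C *ᵥ x) ⬝ᵥ (C *ᵥ x) := by
    intro x
    rw [sub_mulVec, sub_dotProduct, ← mulVec_mulVec, dotProduct_comm (Zᵀ *ᵥ _),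
      dotProduct_transpose_mulVec, mulVec_mulVec, hZ]
  have hWp' := ((posSemidef_real_iff W).1 hWp).2
  have h1 := hL a
  have h2 := hL b
  rw [ha] at h1
  rw [hb] at h2
  have hcomm : a ⬝ᵥ (W *ᵥ b) = b ⬝ᵥ (W *ᵥ a) := by
    rw [dotProduct_mulVec_of_symm hW, dotProduct_comm]
  simp only [sub_dotProduct, add_dotProduct, smul_dotProduct, smul_eq_mul] at h1 h2
  have hCa0 : 0 ≤ (C *ᵥ a) ⬝ᵥ (C *ᵥ a) := by simpa using dotProduct_star_self_nonneg (C *ᵥ a)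
  have hCb0 : 0 ≤ (C *ᵥ b) ⬝ᵥ (C *ᵥ b) := by simpa using dotProduct_star_self_nonneg (C *ᵥ b)
  have h3 := hform a
  have h4 := hform b
  have p1 := mul_nonneg hre (hWp' a)
  have p2 := mul_nonneg hre (hWp' b)
  have p3 := mul_nonneg hs0 (hWp' a)
  have p4 := mul_nonneg hs0 (hWp' b)
  rw [hcomm] at h2
  have hCa : C *ᵥ a = 0 := dotProduct_self_eq_zero.1 (by linarith)
  have hCb : C *ᵥ b = 0 := dotProduct_self_eq_zero.1 (by linarith)
  have hCv : C.map (algebraMap ℝ ℂ) *ᵥ v = 0 := by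
    ext i
    exact Complex.ext ((re_map_mulVec C v i).trans (congrFun hCa i))
      ((im_map_mulVec C v i).trans (congrFun hCb i))
  refine (h μ v hv ?_ hCv).not_ge hre
  rw [← hμ, map_sub_mul, sub_mulVec, ← mulVec_mulVec, hCv, mulVec_zero, sub_zero]

theorem mulVec_eq_zero_of_rank_eq {k l : Type*} [Fintype l] {A : Matrix k l ℂ} [Fintype k]
    (h : A.rank = Fintype.card l) {x : l → ℂ} (hx : A *ᵥ x = 0) : x = 0 := by
  have h1 := LinearMap.finrank_range_add_finrank_ker A.mulVecLin
  rw [← Matrix.rank, h, Module.finrank_fintype_fun_eq_card] at h1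
  have h2 : LinearMap.ker A.mulVecLin = ⊥ := Submodule.finrank_eq_zero.1 (by omega)
  exact (LinearMap.ker_eq_bot'.1 h2) x hx

/-- Detectability of the augmented system. -/
theorem exists_isHurwitz_augmented {m q z : Type*} [Fintype m] [Fintype q] [Fintype z]
    [DecidableEq z] (S : ControlSystem n m p q) (Bplus : Matrix m n ℝ) {M : Matrix z z ℝ}
    (N : Matrix z m ℝ) (Q : Matrix m z ℝ) (hM : IsHurwitz M) (hdet : IsDetectable S.A S.C)
    (h : ∀ μ ∈ spectrum ℂ ((M + N * Q).map (algebraMap ℝ ℂ)), 0 ≤ μ.re →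
      (fromBlocks (S.A.map (algebraMap ℝ ℂ) - μ • (1 : Matrix n n ℂ))
        (S.B.map (algebraMap ℝ ℂ)) (S.C.map (algebraMap ℝ ℂ)) 0).rank =
          Fintype.card n + Fintype.card m) :
    ∃ L : Matrix (n ⊕ z) p ℝ,
      IsHurwitz ((S.augmented Bplus M N Q).A - L * (S.augmented Bplus M N Q).C) := by
  refine exists_isHurwitz_sub_mul _ _ fun μ v hv hA hC => ?_
  simp only [ControlSystem.augmented] at hA hC
  rw [fromBlocks_map_mulVec] at hA
  have h1 := congrArg (· ∘ Sum.inl) hA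
  have h2 := congrArg (· ∘ Sum.inr) hA
  simp only [Sum.elim_comp_inl, Sum.elim_comp_inr, Matrix.map_zero _ (map_zero (algebraMap ℝ ℂ)),
    zero_mulVec, zero_add] at h1 h2
  set x := v ∘ Sum.inl with hx
  set w := v ∘ Sum.inr with hw
  rw [show (μ • v) ∘ Sum.inl = μ • x from rfl] at h1
  rw [show (μ • v) ∘ Sum.inr = μ • w from rfl] at h2
  have h3 : S.C.map (algebraMap ℝ ℂ) *ᵥ x = 0 := by
    have : (fromCols S.C (0 : Matrix p z ℝ)).map (algebraMap ℝ ℂ) = fromCols (S.C.map (algebraMap ℝ ℂ)) 0 := by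
      ext i (j | j) <;> simp
    rw [this, fromCols_mulVec, zero_mulVec, add_zero] at hC
    exact hC
  by_contra! hre
  by_cases hw0 : w = 0
  · obtain ⟨L₀, hL₀⟩ := hdet
    rw [hw0, mulVec_zero, add_zero] at h1
    refine ((isHurwitz_iff _).1 hL₀ μ x (fun hx0 => hv ?_) ?_).not_ge hre
    · rw [← Sum.elim_comp_inl_inr v, ← hx, ← hw, hx0, hw0]
      exact Sum.elim_zero_zero
    · rw [map_sub_mul, sub_mulVec, ← mulVec_mulVec, h3, mulVec_zero, sub_zero]
      exact h1
  · have hrank := h μ ((mem_spectrum_iff_exists_mulVec _ _).2 ⟨w, hw0, h2⟩) hre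
    -- The vector col(x, Qw) lies in the kernel of the rank matrix at μ, so Qw = 0 and w is an
    -- eigenvector of M itself.
    have hz := mulVec_eq_zero_of_rank_eq (hrank.trans Fintype.card_sum.symm)
      (x := Sum.elim x (Q.map (algebraMap ℝ ℂ) *ᵥ w)) (by
        rw [fromBlocks_mulVec]
        simp only [Sum.elim_comp_inl, Sum.elim_comp_inr, h3, zero_mulVec, add_zero, sub_mulVec,
          smul_mulVec, one_mulVec]
        rw [mulVec_mulVec, ← Matrix.map_mul, sub_add_eq_add_sub, h1, sub_self]
        exact Sum.elim_zero_zero)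
    have hQ : Q.map (algebraMap ℝ ℂ) *ᵥ w = 0 := congrArg (· ∘ Sum.inr) hz
    refine ((isHurwitz_iff M).1 hM μ w hw0 ?_).not_ge hre
    rw [← h2, Matrix.map_add _ (map_add _), Matrix.map_mul, add_mulVec, ← mulVec_mulVec, hQ, mulVec_zero, add_zero]

end Detectability

end GammaStab

theorem mainTheorem2 {n m p q nz : ℕ}
    (S : GammaStab.ControlSystem (Fin n) (Fin m) (Fin p) (Fin q))
    (Bplus : Matrix (Fin m) (Fin n) ℝ) (hBplus : Bplus * S.B = 1)
    (M : Matrix (Fin nz) (Fin nz) ℝ) (N : Matrix (Fin nz) (Fin m) ℝ)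
    (Q : Matrix (Fin m) (Fin nz) ℝ)
    (hcon : GammaStab.IsControllable S.A S.B)
    (l : ℕ) (hl : GammaStab.IsNumSVDSteps S.A S.B l)
    (hlevel : ∀ j ∈ Finset.Icc 1 l, S.C * S.A ^ (j - 1) * S.B = 0)
    (hdet : GammaStab.IsDetectable S.A S.C)
    (hM : GammaStab.IsHurwitz M)
    (hMN : GammaStab.IsControllable M N)
    (γ : ℝ) (hγ : 0 < γ)
    (K : Matrix (Fin m) (Fin n) ℝ) (hK : S.SolvedByStateFeedback γ K) :
    (∀ L : Matrix (Fin n ⊕ Fin nz) (Fin p) ℝ,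
      GammaStab.IsHurwitz
        ((S.augmented Bplus M N Q).A - L * (S.augmented Bplus M N Q).C) →
      (S.augmented Bplus M N Q).SolvedByOutputFeedback γ (Matrix.fromCols K (-Q)) L) ∧
    ((∀ μ ∈ spectrum ℂ ((M + N * Q).map (algebraMap ℝ ℂ)), 0 ≤ μ.re →
        (Matrix.fromBlocks
          (S.A.map (algebraMap ℝ ℂ) - μ • (1 : Matrix (Fin n) (Fin n) ℂ))
          (S.B.map (algebraMap ℝ ℂ)) (S.C.map (algebraMap ℝ ℂ)) 0).rank = n + m) →
      ∃ L : Matrix (Fin n ⊕ Fin nz) (Fin p) ℝ,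
        GammaStab.IsHurwitz
          ((S.augmented Bplus M N Q).A - L * (S.augmented Bplus M N Q).C)) := by
  refine ⟨fun L hL => GammaStab.augmented_solvedByOutputFeedback S Bplus N Q hM hK hL,
    fun h => GammaStab.exists_isHurwitz_augmented S Bplus N Q hM hdet ?_⟩
  simpa only [Fintype.card_fin] using h
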